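/- **Theorem (Non-central limit).** Let $q\ge 2$ be an integer and let $\alpha,\beta\in\left(1-\frac1{2q},1\right)$. Let $W=(W_{s,t})_{(s,t)\in[0,1]^2}$ be a fractional Brownian sheet with Hurst indices $(\alpha,\beta)$ on a probability space $(\Omega,\mathcal F,P)$, that is, a centered Gaussian process, vanishing almost surely at each point $(s,t)$ with $s=0$ or $t=0$, with $$\mathbb E[W_{s,t}W_{s',t'}]=\tfrac12\left(s^{2\alpha}+s'^{2\alpha}-|s-s'|^{2\alpha}\right)\cdot\tfrac12\left(t^{2\beta}+t'^{2\beta}-|t-t'|^{2\beta}\right).$$ Let $\mathcal H$ be the closure of the linear span of the indicator functions $\mathbf 1_{[0,s]\times[0,t]}$ for the scalar product $\langle \mathbf 1_{[0,s]\times[0,t]},\mathbf 1_{[0,s']\times[0,t']}\rangle=\mathbb E[W_{s,t}W_{s',t'}]$, let $\varphi\mapsto W(\varphi)$ be the linear isometry $\mathcal H\to L^2(\Omega)$ that extends $\mathbf 1_{[0,s]\times[0,t]}\mapsto W_{s,t}$, let $\mathcal H^{\otimes q}$ be the Hilbert tensor power and let $\mathcal H^{\odot q}\subset\mathcal H^{\otimes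 q}$ be its closed subspace of symmetric tensors, generated by the tensors $\varphi^{\otimes q}$. Let $H_q(x)=\frac{(-1)^q}{q!}e^{x^2/2}\frac{d^q}{dx^q}e^{-x^2/2}$ and, for $\gamma\in\{\alpha,\beta\}$, $$\kappa_\gamma=\frac{\gamma^q(2\gamma-1)^q}{(\gamma q-q+1)(2\gamma q-2q+1)},\qquad \phi_{N,M}=\sqrt{\frac{q!}{\kappa_\alpha\kappa_\beta}}\,N^{q-1}M^{q-1}.$$ Write $\Delta_{i,j}=[\frac iN,\frac{i+1}N]\times[\frac jM,\frac{j+1}M]$, where $\mathbf 1_{\Delta_{i,j}}\in\mathcal H$ is the corresponding combination of the indicators of $[0,s]\times[0,t]$ at the four corners $(s,t)$ of $\Delta_{i,j}$. Then: 1. There is exactly one continuous linear map $I_q:\mathcal H^{\odot q}\to L^2(\Omega)$ with $I_q(\varphi^{\otimes q})=q!\,H_q(W(\varphi))$ for all $\varphi\in\mathcal H$ with $\|\varphi\|=1$ and $\mathbb E[I_q(f)^2]=q!\,\|f\|^2$ for all $f$. 2. For all $s,t\in[0,1]$ the kernels $$h_{N,M}(t,s)=\frac1{q!}\,\phi_{N,M}\sum_{i=0}^{\lfloor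 (N-1)t\rfloor}\ \sum_{j=0}^{\lfloor (M-1)s\rfloor}\mathbf 1_{\Delta_{i,j}}^{\otimes q}$$ converge in $\mathcal H^{\otimes q}$ as $N,M\to\infty$ to a limit $\mu^{(q)}_{t,s}\in\mathcal H^{\odot q}$. The Hermite sheet is defined by $Z^{(q)}_{t,s}=I_q(\mu^{(q)}_{t,s})$. 3. The renormalized Hermite variations $$\tilde V_{N,M}=\frac1{q!}\,\phi_{N,M}\sum_{i=0}^{N-1}\sum_{j=0}^{M-1}I_q\left(\mathbf 1_{\Delta_{i,j}}^{\otimes q}\right)$$ satisfy, almost surely for all $N,M\ge1$, $\tilde V_{N,M}=\phi_{N,M}N^{-\alpha q}M^{-\beta q}V_{N,M}$ with $$V_{N,M}=\sum_{i=0}^{N-1}\sum_{j=0}^{M-1}H_q\left(N^\alpha M^\beta\left(W_{\frac{i+1}N,\frac{j+1}M}-W_{\frac iN,\frac{j+1}M}-W_{\frac{i+1}N,\frac jM}+W_{\frac iN,\frac jM}\right)\right).$$ 4. With $Z=Z^{(q)}_{1,1}$, $$\lim_{N,M\to\infty}\mathbb E\left[|\tilde V_{N,M}-Z|^2\right]=0.$$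 -/

import Mathlib

open MeasureTheory ProbabilityTheory Filter Topology
open scoped unitInterval ENNReal RealInnerProductSpace TensorProduct

noncomputable section

namespace HermiteVariations

/-! ### The fractional Brownian sheet -/

/-- Covariance of the fractional Brownian motion with Hurst index `γ`. -/
def fbmCov (γ s t : ℝ) : ℝ := (s ^ (2 * γ) + t ^ (2 * γ) - |s - t| ^ (2 * γ)) / 2

/-- Covariance of the fractional Brownian sheet with Hurst indices `(α, β)` on `[0,1]²`. -/
def sheetCov (α β : ℝ) (p r : I × I) : ℝ := fbmCov α p.1 r.1 * fbmCov β p.2 r.2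

/-- `W` is a fractional Brownian sheet on `[0,1]²` with Hurst indices `(α, β)`: a centered Gaussian
process with covariance `sheetCov α β` that vanishes on the axes. -/
structure IsFractionalBrownianSheet {Ω : Type*} [MeasurableSpace Ω] (α β : ℝ)
    (W : I × I → Ω → ℝ) (P : Measure Ω) : Prop where
  gaussian : IsGaussianProcess W P
  centered : ∀ p, ∫ ω, W p ω ∂P = 0
  axes : ∀ p : I × I, p.1 = 0 ∨ p.2 = 0 → ∀ᵐ ω ∂P, W p ω = 0
  covariance : ∀ p r, ∫ ω, W p ω * W r ω ∂P = sheetCov α β p r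

/-! ### The canonical Hilbert space of the sheet

A finitely supported `f : I × I →₀ ℝ` stands for the step function `∑ f(s,t) 𝟏_{[0,s]×[0,t]}`
on `[0,1]²`. As `stepFunction_injective` shows, this identifies `I × I →₀ ℝ` with the linear span
of the indicator functions. -/

/-- The step function `∑ f(s,t) 𝟏_{[0,s]×[0,t]}` coded by `f`. In the order of `[0,1]²`, the
rectangle `[0,s] × [0,t]` is `Set.Iic (s, t)`. -/
def stepFunction : (I × I →₀ ℝ) →ₗ[ℝ] (I × I → ℝ) :=
  Finsupp.linearCombination ℝ fun p : I × I => (Set.Iic p).indicator (1 : I × I → ℝ)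

theorem stepFunction_injective : Function.Injective stepFunction := by
  classical
  rw [injective_iff_map_eq_zero]
  intro f hf
  by_contra hne
  obtain ⟨p, hp⟩ := f.support.exists_maximal (Finsupp.support_nonempty_iff.2 hne)
  have h := congrFun hf p
  rw [stepFunction, Finsupp.linearCombination_apply, Finsupp.sum, Finset.sum_apply,
    Finset.sum_eq_single p] at h
  · exact (Finsupp.mem_support_iff.1 hp.prop) (by simpa using h)
  · intro r hr hrp
    have : ¬ p ≤ r := fun hpr => hrp (le_antisymm (hp.le_of_ge hr hpr) hpr)
    simp [Set.indicator, this]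
  · intro hn
    exact absurd hp.prop hn

section Canonical

variable {Ω : Type*} [MeasurableSpace Ω] {α β : ℝ} {W : I × I → Ω → ℝ} {P : Measure Ω}

theorem IsFractionalBrownianSheet.memLp (hW : IsFractionalBrownianSheet α β W P) (p : I × I) :
    MemLp (W p) 2 P :=
  (hW.gaussian.hasGaussianLaw_eval p).memLp (by simp)

/-- Linear combinations of indicators, with the scalar product determined by
`⟨𝟏_{[0,s]×[0,t]}, 𝟏_{[0,s']×[0,t']}⟩ = sheetCov α β (s,t) (s',t')`. -/
def StepSpace (_ : IsFractionalBrownianSheet α β W P) : Type := I × I →₀ ℝ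

namespace StepSpace

variable (hW : IsFractionalBrownianSheet α β W P)

instance : AddCommGroup (StepSpace hW) := inferInstanceAs (AddCommGroup (I × I →₀ ℝ))

instance : Module ℝ (StepSpace hW) := inferInstanceAs (Module ℝ (I × I →₀ ℝ))

/-- The element of `StepSpace hW` coded by a finitely supported function. -/
def of : (I × I →₀ ℝ) ≃ₗ[ℝ] StepSpace hW := LinearEquiv.refl ℝ (I × I →₀ ℝ)

/-- The integral of step functions with respect to the sheet: `𝟏_{[0,s]×[0,t]} ↦ W_{s,t}`. -/
def integral : StepSpace hW →ₗ[ℝ] Lp ℝ 2 P :=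
  (Finsupp.linearCombination ℝ fun p : I × I => (hW.memLp p).toLp (W p)) ∘ₗ (of hW).symm

/-- The scalar product of two step functions. -/
def form (f g : StepSpace hW) : ℝ :=
  ((of hW).symm f).sum fun p a => ((of hW).symm g).sum fun r b => a * b * sheetCov α β p r

theorem inner_integral (f g : StepSpace hW) :
    ⟪integral hW f, integral hW g⟫ = form hW f g := by
  have key : ∀ p r : I × I,
      ⟪(hW.memLp p).toLp (W p), (hW.memLp r).toLp (W r)⟫ = sheetCov α β p r := by
    intro p r
    rw [← hW.covariance p r, L2.inner_def]
    refine integral_congr_ae ?_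
    filter_upwards [(hW.memLp p).coeFn_toLp, (hW.memLp r).coeFn_toLp] with ω h1 h2
    rw [h1, h2]
    simp [mul_comm]
  simp only [integral, form, LinearMap.comp_apply, LinearEquiv.coe_coe,
    Finsupp.linearCombination_apply, Finsupp.sum, sum_inner, inner_sum, inner_smul_right,
    inner_smul_left, key]
  simp only [Finset.mul_sum]
  rw [Finset.sum_comm]
  refine Finset.sum_congr rfl fun p _ => Finset.sum_congr rfl fun r _ => ?_
  simp [mul_left_comm, mul_assoc]

/-- Positivity is inherited from the covariance of the sheet. -/
instance : PreInnerProductSpace.Core ℝ (StepSpace hW) where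
  inner f g := form hW f g
  conj_inner_symm f g := by
    simp only [← inner_integral hW]
    exact real_inner_comm (StepSpace.integral hW f) (StepSpace.integral hW g)
  re_inner_nonneg f := by
    simp only [← inner_integral hW]
    exact real_inner_self_nonneg (x := StepSpace.integral hW f)
  add_left f g k := by
    simp only [← inner_integral hW, map_add, inner_add_left]
  smul_left f g r := by
    simp only [← inner_integral hW, map_smul, inner_smul_left]

instance : SeminormedAddCommGroup (StepSpace hW) :=
  InnerProductSpace.Core.toSeminormedAddCommGroup (𝕜 := ℝ)

instance : InnerProductSpace ℝ (StepSpace hW) := .ofCore _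

/-- `StepSpace.integral` is an isometry. -/
def integralIsometry : StepSpace hW →ₗᵢ[ℝ] Lp ℝ 2 P :=
  (integral hW).isometryOfInner (inner_integral hW)

end StepSpace

variable (hW : IsFractionalBrownianSheet α β W P)

/-- The canonical Hilbert space of the sheet: the closure of the linear span of the indicator
functions of `[0,s] × [0,t]` for the scalar product given by the covariance. -/
abbrev CanonicalSpace : Type := UniformSpace.Completion (StepSpace hW)

/-- The image `W(φ)` of `φ` under the isometry from the canonical space to the first chaos
that extends `𝟏_{[0,s]×[0,t]} ↦ W_{s,t}`. -/
def wiener : CanonicalSpace hW →L[ℝ] Lp ℝ 2 P :=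
  (StepSpace.integralIsometry hW).toContinuousLinearMap.extend UniformSpace.Completion.toComplL

/-- Formal step function of the rectangle with corners `(s, t)` and `(s', t')`. -/
def rectStep (s s' t t' : I) : I × I →₀ ℝ :=
  .single (s', t') 1 - .single (s, t') 1 - .single (s', t) 1 + .single (s, t) 1

theorem stepFunction_rectStep {s s' t t' : I} (hs : s ≤ s') (ht : t ≤ t') :
    stepFunction (rectStep s s' t t') =
      (Set.Ioc s s' ×ˢ Set.Ioc t t').indicator (1 : I × I → ℝ) := by
  classical
  funext ⟨u, v⟩
  simp only [stepFunction, rectStep, map_add, map_sub, Finsupp.linearCombination_single, one_smul,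
    Pi.add_apply, Pi.sub_apply, Set.indicator, Set.mem_Iic, Prod.mk_le_mk, Set.mem_prod,
    Set.mem_Ioc, Pi.one_apply]
  by_cases h1 : u ≤ s <;> by_cases h2 : u ≤ s' <;> by_cases h3 : v ≤ t <;> by_cases h4 : v ≤ t' <;>
    simp [h1, h2, h3, h4, not_le.1, ← not_le] <;>
    first
      | exact absurd (h1.trans hs) h2
      | exact absurd (h3.trans ht) h4

/-- The point `i / N` of `[0,1]` (for `i ≤ N`). -/
def gridPoint (N i : ℕ) : I := Set.projIcc (0 : ℝ) 1 zero_le_one ((i : ℝ) / N)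

/-- The indicator function of `[i/N, (i+1)/N] × [j/M, (j+1)/M]`, as an element of the canonical
Hilbert space. -/
def cell (N M i j : ℕ) : CanonicalSpace hW :=
  ((StepSpace.of hW (rectStep (gridPoint N i) (gridPoint N (i + 1))
    (gridPoint M j) (gridPoint M (j + 1))) : StepSpace hW) : CanonicalSpace hW)

end Canonical

/-! ### Hilbert tensor powers -/

section Tensor

variable (H : Type*) [NormedAddCommGroup H] [InnerProductSpace ℝ H] (n : ℕ)

/-- The algebraic tensor power of `H`, to be equipped with the scalar product determined by
`⟨f₁ ⊗ ⋯ ⊗ fₙ, g₁ ⊗ ⋯ ⊗ gₙ⟩ = ∏ ⟨fᵢ, gᵢ⟩`. -/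
def AlgTensorPower : Type _ := ⨂[ℝ] _ : Fin n, H

namespace AlgTensorPower

instance : AddCommGroup (AlgTensorPower H n) := inferInstanceAs (AddCommGroup (⨂[ℝ] _ : Fin n, H))

instance : Module ℝ (AlgTensorPower H n) := inferInstanceAs (Module ℝ (⨂[ℝ] _ : Fin n, H))

/-- The identification with the algebraic tensor power. -/
def of : (⨂[ℝ] _ : Fin n, H) ≃ₗ[ℝ] AlgTensorPower H n := LinearEquiv.refl ℝ (⨂[ℝ] _ : Fin n, H)

variable {H n}

/-- The elementary tensor `f₁ ⊗ ⋯ ⊗ fₙ`. -/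
def pure (f : Fin n → H) : AlgTensorPower H n := of H n (PiTensorProduct.tprod ℝ f)

variable (H n) in
/-- The bilinear form `⟨⊗ fᵢ, ⊗ gᵢ⟩ = ∏ ⟨fᵢ, gᵢ⟩`. -/
def form : AlgTensorPower H n →ₗ[ℝ] AlgTensorPower H n →ₗ[ℝ] ℝ :=
  ((PiTensorProduct.dualDistrib (R := ℝ) (M := fun _ : Fin n => H)) ∘ₗ
    (PiTensorProduct.map fun _ : Fin n => innerₗ H)).compl₁₂
      (of H n).symm.toLinearMap (of H n).symm.toLinearMap

theorem form_pure (f g : Fin n → H) : form H n (pure f) (pure g) = ∏ i, ⟪f i, g i⟫ := by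
  simp [form, pure, PiTensorProduct.map_tprod, PiTensorProduct.dualDistrib_apply]

theorem exists_eq_sum (x : AlgTensorPower H n) :
    ∃ c : (Fin n → H) →₀ ℝ, c.sum (fun f a => a • pure f) = x := by
  have hx : (of H n).symm x ∈
      Submodule.span ℝ (Set.range (PiTensorProduct.tprod ℝ : _ → ⨂[ℝ] _ : Fin n, H)) := by
    rw [PiTensorProduct.span_tprod_eq_top]; trivial
  obtain ⟨c, hc⟩ := (Finsupp.mem_span_range_iff_exists_finsupp).1 hx
  refine ⟨c, (of H n).symm.injective ?_⟩
  rw [← hc]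
  simp [Finsupp.sum, pure]

theorem form_sum (c d : (Fin n → H) →₀ ℝ) :
    form H n (c.sum fun f a => a • pure f) (d.sum fun f a => a • pure f) =
      c.sum fun f a => d.sum fun g b => a * (b * ∏ i, ⟪f i, g i⟫) := by
  simp only [Finsupp.sum, map_sum, LinearMap.sum_apply, map_smul, LinearMap.smul_apply, form_pure,
    smul_eq_mul, Finset.mul_sum]
  rw [Finset.sum_comm]
  simp only [mul_left_comm]

theorem form_symm (x y : AlgTensorPower H n) : form H n x y = form H n y x := by
  obtain ⟨c, rfl⟩ := exists_eq_sum x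
  obtain ⟨d, rfl⟩ := exists_eq_sum y
  rw [form_sum, form_sum, Finsupp.sum_comm]
  simp only [real_inner_comm, mul_left_comm]

theorem posSemidef_inner {X E : Type*} [NormedAddCommGroup E] [InnerProductSpace ℝ E] (v : X → E) :
    (Matrix.of fun x y => ⟪v x, v y⟫).PosSemidef := by
  refine ⟨Matrix.ext fun x y => by simp [real_inner_comm], fun c => ?_⟩
  have h : 0 ≤ ⟪∑ x ∈ c.support, c x • v x, ∑ y ∈ c.support, c y • v y⟫ := real_inner_self_nonneg
  simp only [sum_inner, inner_sum, inner_smul_left, inner_smul_right,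
    Finset.mul_sum] at h
  rw [Finset.sum_comm] at h
  simpa [Finsupp.sum, mul_comm, mul_left_comm, mul_assoc, Finset.mul_sum] using h

theorem posSemidef_prod (s : Finset (Fin n)) :
    (Matrix.of fun f g : Fin n → H => ∏ i ∈ s, ⟪f i, g i⟫).PosSemidef := by
  classical
  induction s using Finset.induction_on with
  | empty => simpa using posSemidef_inner (fun _ : Fin n → H => (1 : ℝ))
  | insert i s hi ih =>
    have h := (posSemidef_inner (fun f : Fin n → H => f i)).hadamard ih
    have e : (Matrix.of fun f g : Fin n → H => ∏ j ∈ insert i s, ⟪f j, g j⟫) =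
        Matrix.hadamard (Matrix.of fun f g : Fin n → H => ⟪f i, g i⟫)
          (Matrix.of fun f g : Fin n → H => ∏ j ∈ s, ⟪f j, g j⟫) := by
      ext f g
      simp [Finset.prod_insert hi]
    rw [e]
    exact h

theorem form_nonneg (x : AlgTensorPower H n) : 0 ≤ form H n x x := by
  obtain ⟨c, rfl⟩ := exists_eq_sum x
  rw [form_sum]
  have h := (posSemidef_prod (H := H) (Finset.univ : Finset (Fin n))).2 c
  simpa [mul_comm, mul_left_comm, mul_assoc] using h

instance : PreInnerProductSpace.Core ℝ (AlgTensorPower H n) where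
  inner x y := form H n x y
  conj_inner_symm x y := form_symm y x
  re_inner_nonneg x := form_nonneg x
  add_left x y z := by simp
  smul_left x y r := by simp

instance : SeminormedAddCommGroup (AlgTensorPower H n) :=
  InnerProductSpace.Core.toSeminormedAddCommGroup (𝕜 := ℝ)

instance : InnerProductSpace ℝ (AlgTensorPower H n) := .ofCore _

end AlgTensorPower

/-- The Hilbert tensor power `H^{⊗n}`. -/
abbrev TensorPower : Type _ := UniformSpace.Completion (AlgTensorPower H n)

variable {H} in
/-- The tensor `φ^{⊗n}`. -/
def tensorPow (φ : H) : TensorPower H n := (AlgTensorPower.pure fun _ : Fin n => φ :)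

/-- The symmetric tensor power `H^{⊙n}`, the closed subspace of `H^{⊗n}` generated by the tensors
`φ^{⊗n}`; by polarization it is the space of all symmetric tensors. -/
def symTensorPower : Submodule ℝ (TensorPower H n) :=
  (Submodule.span ℝ (Set.range (tensorPow (H := H) n))).topologicalClosure

variable {H} in
/-- The tensor `φ^{⊗n}`, as an element of `H^{⊙n}`. -/
def symPow (φ : H) : symTensorPower H n :=
  ⟨tensorPow n φ, Submodule.le_topologicalClosure _ (Submodule.subset_span ⟨φ, rfl⟩)⟩

end Tensor

/-! ### Multiple integrals, Hermite variations and the Hermite sheet -/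

/-- The Hermite polynomial `Hₙ(x) = ((-1)ⁿ / n!) e^{x²/2} (d/dx)ⁿ e^{-x²/2}`. -/
def hermitePoly (n : ℕ) (x : ℝ) : ℝ := Polynomial.aeval x (Polynomial.hermite n) / n.factorial

/-- The constant `κ_γ` (which depends also on the order `q`). -/
def kappa (q : ℕ) (γ : ℝ) : ℝ :=
  γ ^ q * (2 * γ - 1) ^ q / ((γ * q - q + 1) * (2 * γ * q - 2 * q + 1))

/-- The normalization `φ(α, β, N, M)`. -/
def normalization (q : ℕ) (α β : ℝ) (N M : ℕ) : ℝ :=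
  √(q.factorial / (kappa q α * kappa q β)) * (N : ℝ) ^ (q - 1) * (M : ℝ) ^ (q - 1)

section Variations

variable {Ω : Type*} [MeasurableSpace Ω] {α β : ℝ} {W : I × I → Ω → ℝ} {P : Measure Ω}

variable (α β W) in
/-- The Hermite variation `V_{N,M}` of order `q`. -/
def hermiteVariation (q N M : ℕ) (ω : Ω) : ℝ :=
  ∑ i ∈ Finset.range N, ∑ j ∈ Finset.range M,
    hermitePoly q ((N : ℝ) ^ α * (M : ℝ) ^ β *
      (W (gridPoint N (i + 1), gridPoint M (j + 1)) ω - W (gridPoint N i, gridPoint M (j + 1)) ω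
        - W (gridPoint N (i + 1), gridPoint M j) ω + W (gridPoint N i, gridPoint M j) ω))

variable (hW : IsFractionalBrownianSheet α β W P) (q : ℕ)

/-- `J` is the multiple integral of order `q`: the linear map on `H^{⊙q}` that takes `φ^{⊗q}` to
`q! H_q(W(φ))` for every unit vector `φ`, and that is isometric up to the factor `q!`. -/
structure IsMultipleIntegral (J : symTensorPower (CanonicalSpace hW) q →L[ℝ] Lp ℝ 2 P) :
    Prop where
  map_symPow : ∀ φ : CanonicalSpace hW, ‖φ‖ = 1 →
    ∀ᵐ ω ∂P, J (symPow q φ) ω = q.factorial * hermitePoly q (wiener hW φ ω)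
  norm_sq : ∀ f, ‖J f‖ ^ 2 = q.factorial * ‖f‖ ^ 2

open Classical in
/-- The multiple integral `I_q` with respect to the sheet. -/
def multipleIntegral : symTensorPower (CanonicalSpace hW) q →L[ℝ] Lp ℝ 2 P :=
  if h : ∃ J, IsMultipleIntegral hW q J then h.choose else 0

/-- The renormalized Hermite variation
`Ṽ_{N,M} = (1/q!) φ(α,β,N,M) ∑ᵢ ∑ⱼ I_q(𝟏_{[i/N,(i+1)/N]×[j/M,(j+1)/M]}^{⊗q})`. -/
def renormalizedVariation (N M : ℕ) : Lp ℝ 2 P :=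
  (1 / (q.factorial : ℝ) * normalization q α β N M) •
    ∑ i ∈ Finset.range N, ∑ j ∈ Finset.range M, multipleIntegral hW q (symPow q (cell hW N M i j))

/-- The kernel `h_{N,M}(t, s)`, with the sums over `0 ≤ i ≤ [(N-1)t]` and `0 ≤ j ≤ [(M-1)s]`;
`h_{N,M}(1, 1)` is the kernel of `Ṽ_{N,M}`. -/
def kernel (t s : I) (N M : ℕ) : symTensorPower (CanonicalSpace hW) q :=
  (1 / (q.factorial : ℝ) * normalization q α β N M) •
    ∑ i ∈ Finset.range (⌊((N : ℝ) - 1) * t⌋₊ + 1), ∑ j ∈ Finset.range (⌊((M : ℝ) - 1) * s⌋₊ + 1),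
      symPow q (cell hW N M i j)

/-- The limit `μ^{(q)}_{t,s}` of the kernels `h_{N,M}(t, s)` as `N, M → ∞`. -/
def limitKernel (t s : I) : symTensorPower (CanonicalSpace hW) q :=
  limUnder atTop fun p : ℕ × ℕ => kernel hW q t s p.1 p.2

/-- The Hermite sheet `Z^{(q)}_{t,s} = I_q(μ^{(q)}_{t,s})`. -/
def hermiteSheet (t s : I) : Lp ℝ 2 P := multipleIntegral hW q (limitKernel hW q t s)

end Variations

end HermiteVariations

end

/-!
Gaussian integration by parts turns the expectation of `Heₙ(G) r(G)`, for a polynomial `r`, into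
that of the `n`-th derivative of `r` at `G`. For a unit vector `φ` and `W(ψ) = ⟪φ, ψ⟫ W(φ) + R`
with `R` independent of `W(φ)`, this yields `E[He_q(W(φ)) He_q(W(ψ))] = q! ⟪φ, ψ⟫ ^ q`. Up to the
factor `q!` these are the inner products of the tensors `φ^{⊗q}`, hence the existence of `I_q`,
and its uniqueness because the powers of unit vectors span a dense subspace.

Likewise `⟪h_{N,M}, h_{N',M'}⟫` is a constant times a sum of `q`-th powers of covariances of
rectangular increments. Such a covariance is a product over the two parameters, and so is the sum.
Each factor is the integral of the `q`-th power of a step function which converges, off the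
diagonal, to `γ (2γ - 1) |u - v| ^ (2γ - 2)` and is bounded by `8 |u - v| ^ (2γ - 2)`. As
`(2γ - 2) q > -1`, dominated convergence applies. A family whose inner products converge along
both indices to the same number is Cauchy, so the kernels converge, and `I_q` carries the
convergence over to `L²`.
-/

namespace HermiteVariations

/-! ### Hermite polynomials and the Gaussian law -/

section Hermite

open Polynomial

theorem integrable_eval_gaussianReal (p : ℝ[X]) (m : ℝ) (v : NNReal) :
    Integrable (fun x => p.eval x) (gaussianReal m v) := by
  simp only [eval_eq_sum_range]
  refine integrable_finsetSum _ fun i _ => Integrable.const_mul ?_ _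
  have h := (memLp_id_gaussianReal (μ := m) (v := v) i).integrable_norm_pow'
  exact h.mono' (by fun_prop) (ae_of_all _ fun x => by simp)

theorem memLp_eval_gaussianReal (p : ℝ[X]) (m : ℝ) (v : NNReal) :
    MemLp (fun x => p.eval x) 2 (gaussianReal m v) := by
  rw [memLp_two_iff_integrable_sq (by fun_prop)]
  exact (integrable_eval_gaussianReal (p ^ 2) m v).congr (ae_of_all _ fun x => eval_pow 2)

theorem hasDerivAt_gaussianPDFReal (m : ℝ) (v : NNReal) (x : ℝ) :
    HasDerivAt (gaussianPDFReal m v) (-((x - m) / v) * gaussianPDFReal m v x) x := by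
  have hexponent : HasDerivAt (fun x : ℝ => -(x - m) ^ 2 / (2 * v)) (-((x - m) / v)) x := by
    refine ((((hasDerivAt_id x).sub_const m).pow 2).neg.div_const (2 * (v : ℝ))).congr_deriv ?_
    simp only [id_eq, Nat.cast_ofNat, Nat.add_one_sub_one, pow_one, mul_one, neg_div,
      mul_div_mul_left _ _ (two_ne_zero' ℝ)]
  rw [gaussianPDFReal_def]
  exact (hexponent.exp.const_mul (√(2 * Real.pi * v))⁻¹).congr_deriv (by ring)

theorem integrable_eval_mul_gaussianPDFReal (p : ℝ[X]) (m : ℝ) {v : NNReal} (hv : v ≠ 0) :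
    Integrable (fun x => p.eval x * gaussianPDFReal m v x) := by
  have h := integrable_eval_gaussianReal p m v
  rw [gaussianReal_of_var_ne_zero _ hv, integrable_withDensity_iff_integrable_smul'
    (measurable_gaussianPDF _ _) (ae_of_all _ fun x => gaussianPDF_lt_top)] at h
  simpa only [toReal_gaussianPDF, smul_eq_mul, mul_comm] using h

theorem integral_sub_mul_eval_gaussianReal (p : ℝ[X]) (m : ℝ) (v : NNReal) :
    ∫ x, (x - m) * p.eval x ∂gaussianReal m v =
      v * ∫ x, (derivative p).eval x ∂gaussianReal m v := by
  rcases eq_or_ne v 0 with rfl | hv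
  · simp [gaussianReal_zero_var]
  have hv' : (v : ℝ) ≠ 0 := by exact_mod_cast hv
  have hparts : ∫ x, p.eval x * (-((x - m) / v) * gaussianPDFReal m v x) =
      -∫ x, (derivative p).eval x * gaussianPDFReal m v x := by
    refine integral_mul_deriv_eq_deriv_mul_of_integrable (fun x _ => p.hasDerivAt x)
      (fun x _ => hasDerivAt_gaussianPDFReal m v x) ?_
      (integrable_eval_mul_gaussianPDFReal _ m hv) (integrable_eval_mul_gaussianPDFReal _ m hv)
    refine (integrable_eval_mul_gaussianPDFReal (p * (C (-1 / (v : ℝ)) * (X - C m))) m hv).congr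
      (ae_of_all _ fun x => ?_)
    simp only [eval_mul, eval_C, eval_sub, eval_X, Pi.mul_apply]
    ring
  rw [integral_gaussianReal_eq_integral_smul hv, integral_gaussianReal_eq_integral_smul hv]
  calc ∫ x, gaussianPDFReal m v x • ((x - m) * p.eval x)
      = -v * ∫ x, p.eval x * (-((x - m) / v) * gaussianPDFReal m v x) := by
        rw [← integral_const_mul]
        congr 1 with x
        simp only [smul_eq_mul]
        field_simp
    _ = v * ∫ x, gaussianPDFReal m v x • (derivative p).eval x := by
        rw [hparts]
        simp only [neg_mul_neg, smul_eq_mul, mul_comm]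

theorem integral_eval_hermite_mul_eval (n : ℕ) (r : ℝ[X]) :
    ∫ x, aeval x (hermite n) * r.eval x ∂gaussianReal 0 1 =
      ∫ x, (derivative^[n] r).eval x ∂gaussianReal 0 1 := by
  induction n generalizing r with
  | zero => simp
  | succ n ih =>
    set p : ℝ[X] := (hermite n).map (algebraMap ℤ ℝ) with hp
    have hp_eval : ∀ x : ℝ, aeval x (hermite n) = p.eval x :=
      fun x => (eval_map_algebraMap _ _).symm
    have hintg : ∀ s : ℝ[X], Integrable (fun x => s.eval x) (gaussianReal 0 1) :=
      fun s => integrable_eval_gaussianReal s 0 1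
    have hstein := integral_sub_mul_eval_gaussianReal (p * r) 0 1
    rw [Function.iterate_succ_apply, ← ih]
    calc ∫ x, aeval x (hermite (n + 1)) * r.eval x ∂gaussianReal 0 1
        = ∫ x, ((X * (p * r)).eval x - (derivative p * r).eval x) ∂gaussianReal 0 1 := by
          congr 1 with x
          have hp_deriv : aeval x (derivative (hermite n)) = (derivative p).eval x := by
            rw [hp, derivative_map, eval_map_algebraMap]
          simp only [hermite_succ, map_sub, map_mul, aeval_X, hp_eval, hp_deriv, eval_mul, eval_X]
          ring
      _ = ∫ x, ((derivative (p * r)).eval x - (derivative p * r).eval x) ∂gaussianReal 0 1 := by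
          rw [integral_sub (hintg _) (hintg _), integral_sub (hintg _) (hintg _)]
          simpa using hstein
      _ = ∫ x, aeval x (hermite n) * (derivative r).eval x ∂gaussianReal 0 1 := by
          congr 1 with x
          simp [derivative_mul, hp_eval]

theorem integral_eval_hermite_mul_eval_of_natDegree_le {n : ℕ} {r : ℝ[X]} (hr : r.natDegree ≤ n) :
    ∫ x, aeval x (hermite n) * r.eval x ∂gaussianReal 0 1 = n.factorial * r.coeff n := by
  have hdegree : (derivative^[n] r).natDegree = 0 := by
    have := natDegree_iterate_derivative r n
    lia
  rw [integral_eval_hermite_mul_eval, eq_C_of_natDegree_eq_zero hdegree]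
  simp [coeff_iterate_derivative, Nat.descFactorial_self]

theorem integral_eval_hermite_mul_eval_hermite_comp (n : ℕ) (ρ z : ℝ) :
    ∫ x, aeval x (hermite n) * aeval (ρ * x + z) (hermite n) ∂gaussianReal 0 1 =
      n.factorial * ρ ^ n := by
  set p : ℝ[X] := (hermite n).map (algebraMap ℤ ℝ) with hp
  have hp_monic : p.Monic := (hermite_monic n).map _
  have hp_degree : p.natDegree = n := by
    rw [hp, (hermite_monic n).natDegree_map, natDegree_hermite]
  set r : ℝ[X] := (taylor z p).comp (C ρ * X)
  have hr_degree : r.natDegree ≤ n := by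
    refine natDegree_comp_le.trans ?_
    rw [natDegree_taylor, hp_degree]
    exact mul_le_of_le_one_right' ((natDegree_C_mul_le ρ X).trans natDegree_X_le)
  have hr_coeff : r.coeff n = ρ ^ n := by
    have hlead : (taylor z p).coeff n = 1 := by
      simpa only [hp_degree, hp_monic.leadingCoeff] using coeff_taylor_natDegree z p
    rw [comp_C_mul_X_coeff, hlead, one_mul]
  have hr_eval : ∀ x, aeval (ρ * x + z) (hermite n) = r.eval x := fun x => by
    rw [← eval_map_algebraMap]
    simp [r, p, eval_comp, taylor_eval]
  simp only [hr_eval, integral_eval_hermite_mul_eval_of_natDegree_le hr_degree, hr_coeff]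

end Hermite

/-! ### Isonormal processes -/

section Isonormal

open Polynomial

variable {Ω : Type*} [MeasurableSpace Ω] {P : Measure Ω}

theorem inner_Lp_eq_integral (f g : Lp ℝ 2 P) : ⟪f, g⟫ = ∫ ω, f ω * g ω ∂P := by
  simp only [L2.inner_def, RCLike.inner_apply, conj_trivial, mul_comm]

theorem norm_Lp_sq_eq_integral (f : Lp ℝ 2 P) : ‖f‖ ^ 2 = ∫ ω, f ω ^ 2 ∂P := by
  rw [← real_inner_self_eq_norm_sq, inner_Lp_eq_integral]
  simp only [sq]

theorem hasLaw_gaussianReal_of_integral_eq_zero {f : Lp ℝ 2 P} (hf : HasGaussianLaw f P)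
    (hmean : ∫ ω, f ω ∂P = 0) : HasLaw f (gaussianReal 0 (‖f‖₊ ^ 2)) P := by
  refine ⟨hf.aemeasurable, ?_⟩
  rw [hf.map_eq_gaussianReal, hmean, variance_of_integral_eq_zero hf.aemeasurable hmean,
    ← norm_Lp_sq_eq_integral]
  congr 1
  ext
  simp

variable {H : Type*} [NormedAddCommGroup H] [InnerProductSpace ℝ H]

/-- `X` is an isonormal Gaussian process over `H`. Linearity makes the one-dimensional laws
sufficient: they determine the law of every `(X φ₁, …, X φₙ)` and force `X` to be isometric. -/
def IsIsonormal (X : H →L[ℝ] Lp ℝ 2 P) : Prop :=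
  ∀ φ, HasLaw (X φ) (gaussianReal 0 (‖φ‖₊ ^ 2)) P

theorem coeFn_map_smul_add_smul (X : H →L[ℝ] Lp ℝ 2 P) (a b : ℝ) (φ ψ : H) :
    X (a • φ + b • ψ) =ᵐ[P] fun ω => a * X φ ω + b * X ψ ω := by
  rw [map_add, map_smul, map_smul]
  filter_upwards [Lp.coeFn_add (a • X φ) (b • X ψ), Lp.coeFn_smul a (X φ),
    Lp.coeFn_smul b (X ψ)] with ω hadd hφ hψ
  rw [hadd, Pi.add_apply, hφ, hψ, Pi.smul_apply, Pi.smul_apply, smul_eq_mul, smul_eq_mul]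

theorem continuous_charFun_map_Lp [IsProbabilityMeasure P] {p : ℝ≥0∞} [Fact (1 ≤ p)] (t : ℝ) :
    Continuous fun f : Lp ℝ p P => charFun (P.map f) t := by
  refine continuous_iff_seqContinuous.2 fun f g hf => ?_
  have hlaws := (tendstoInMeasure_of_tendsto_Lp hf).tendstoInDistribution
    fun k => (Lp.aestronglyMeasurable (f k)).aemeasurable
  exact ProbabilityMeasure.tendsto_iff_tendsto_charFun.1 hlaws.tendsto t

namespace IsIsonormal

variable {X : H →L[ℝ] Lp ℝ 2 P}

theorem isProbabilityMeasure (hX : IsIsonormal X) : IsProbabilityMeasure P :=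
  (hX 0).isProbabilityMeasure

theorem aemeasurable (hX : IsIsonormal X) (φ : H) : AEMeasurable (X φ) P :=
  (hX φ).aemeasurable

theorem of_dense [IsProbabilityMeasure P] {s : Set H} (hs : Dense s)
    (h : ∀ φ ∈ s, HasLaw (X φ) (gaussianReal 0 (‖φ‖₊ ^ 2)) P) : IsIsonormal X := by
  have hmeas : ∀ φ, AEMeasurable (X φ) P := fun φ => (Lp.aestronglyMeasurable _).aemeasurable
  have hcharFun : ∀ t φ, charFun (P.map (X φ)) t = charFun (gaussianReal 0 (‖φ‖₊ ^ 2)) t := by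
    intro t
    refine congrFun (Continuous.ext_on hs ((continuous_charFun_map_Lp t).comp X.continuous) ?_
      fun φ hφ => congrArg (charFun · t) (h φ hφ).map_eq)
    simp only [charFun_gaussianReal]
    fun_prop
  intro φ
  have := Measure.isProbabilityMeasure_map (hmeas φ)
  exact ⟨hmeas φ, Measure.ext_of_charFun (funext fun t => hcharFun t φ)⟩

theorem integral_eq_zero (hX : IsIsonormal X) (φ : H) : ∫ ω, X φ ω ∂P = 0 := by
  rw [(hX φ).integral_eq, integral_id_gaussianReal]

theorem norm_map (hX : IsIsonormal X) (φ : H) : ‖X φ‖ = ‖φ‖ := by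
  have hvar : ∫ ω, X φ ω ^ 2 ∂P = ‖φ‖ ^ 2 := by
    rw [← variance_of_integral_eq_zero (hX.aemeasurable φ) (hX.integral_eq_zero φ),
      (hX φ).variance_eq, variance_id_gaussianReal]
    simp
  rw [← sq_eq_sq₀ (norm_nonneg _) (norm_nonneg _), norm_Lp_sq_eq_integral, hvar]

theorem inner_map_map (hX : IsIsonormal X) (φ ψ : H) : ⟪X φ, X ψ⟫ = ⟪φ, ψ⟫ :=
  LinearIsometry.inner_map_map ⟨X.toLinearMap, hX.norm_map⟩ φ ψ

theorem hasGaussianLaw_prodMk (hX : IsIsonormal X) (φ ψ : H) :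
    HasGaussianLaw (fun ω => (X φ ω, X ψ ω)) P := by
  have hmeas : AEMeasurable (fun ω => (X φ ω, X ψ ω)) P :=
    (hX.aemeasurable φ).prodMk (hX.aemeasurable ψ)
  refine ⟨isGaussian_of_map_eq_gaussianReal fun L => ?_⟩
  have hL : L ∘ (fun ω => (X φ ω, X ψ ω)) =ᵐ[P] X (L (1, 0) • φ + L (0, 1) • ψ) := by
    filter_upwards [coeFn_map_smul_add_smul X (L (1, 0)) (L (0, 1)) φ ψ] with ω hω
    have hdecomp : (X φ ω, X ψ ω) = X φ ω • ((1, 0) : ℝ × ℝ) + X ψ ω • (0, 1) := by simp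
    rw [hω, Function.comp_apply, hdecomp, map_add, map_smul, map_smul]
    simp only [smul_eq_mul, mul_comm]
  exact ⟨0, _, by
    rw [AEMeasurable.map_map_of_aemeasurable (by fun_prop) hmeas, Measure.map_congr hL,
      (hX _).map_eq]⟩

theorem indepFun_of_inner_eq_zero (hX : IsIsonormal X) {φ ψ : H} (h : ⟪φ, ψ⟫ = 0) :
    IndepFun (X φ) (X ψ) P := by
  have := hX.isProbabilityMeasure
  refine (hX.hasGaussianLaw_prodMk φ ψ).indepFun_of_covariance_eq_zero ?_
  rw [covariance_eq_sub (Lp.memLp _) (Lp.memLp _), hX.integral_eq_zero, zero_mul, sub_zero,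
    ← h, ← hX.inner_map_map, inner_Lp_eq_integral]
  rfl

theorem memLp_eval_hermite (hX : IsIsonormal X) (n : ℕ) (φ : H) :
    MemLp (fun ω => aeval (X φ ω) (hermite n)) 2 P := by
  have h := memLp_eval_gaussianReal ((hermite n).map (algebraMap ℤ ℝ)) 0 (‖φ‖₊ ^ 2)
  simp only [eval_map_algebraMap] at h
  rw [← (hX φ).map_eq] at h
  exact h.comp_of_map (hX.aemeasurable φ)

theorem integral_eval_hermite_mul_eval_hermite (hX : IsIsonormal X) (n : ℕ) {φ : H}
    (hφ : ‖φ‖ = 1) (ψ : H) :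
    ∫ ω, aeval (X φ ω) (hermite n) * aeval (X ψ ω) (hermite n) ∂P =
      n.factorial * ⟪φ, ψ⟫ ^ n := by
  have := hX.isProbabilityMeasure
  set ρ := ⟪φ, ψ⟫
  set ζ := ψ - ρ • φ with hζ
  have horth : ⟪φ, ζ⟫ = 0 := by
    rw [hζ, inner_sub_right, inner_smul_right, real_inner_self_eq_norm_sq, hφ]
    simp [ρ]
  have hψ : X ψ =ᵐ[P] fun ω => ρ * X φ ω + X ζ ω := by
    simpa [hζ] using coeFn_map_smul_add_smul X ρ 1 φ ζ
  have hlaw : HasLaw (fun ω => (X φ ω, X ζ ω))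
      ((gaussianReal 0 1).prod (gaussianReal 0 (‖ζ‖₊ ^ 2))) P := by
    have hφ1 : HasLaw (X φ) (gaussianReal 0 1) P := by
      have hnnnorm : ‖φ‖₊ = 1 := NNReal.eq hφ
      simpa [hnnnorm] using hX φ
    exact (indepFun_iff_hasLaw_prodMk_prod hφ1 (hX ζ)).1 (hX.indepFun_of_inner_eq_zero horth)
  set F : ℝ × ℝ → ℝ := fun x => aeval x.1 (hermite n) * aeval (ρ * x.1 + x.2) (hermite n)
  have hF : Continuous F := by fun_prop
  have heq : (fun ω => aeval (X φ ω) (hermite n) * aeval (X ψ ω) (hermite n)) =ᵐ[P]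
      F ∘ fun ω => (X φ ω, X ζ ω) := by
    filter_upwards [hψ] with ω hω
    simp only [F, hω, Function.comp_apply]
  have hintg : Integrable F ((gaussianReal 0 1).prod (gaussianReal 0 (‖ζ‖₊ ^ 2))) := by
    rw [← hlaw.map_eq, integrable_map_measure hF.aestronglyMeasurable hlaw.aemeasurable]
    exact ((hX.memLp_eval_hermite n φ).integrable_mul (hX.memLp_eval_hermite n ψ)).congr heq
  rw [integral_congr_ae heq, hlaw.integral_comp hF.aestronglyMeasurable, integral_prod_symm _ hintg]
  simp [F, integral_eval_hermite_mul_eval_hermite_comp]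

/-- The random variable `Heₙ(X(φ))`, for the monic Hermite polynomial `Heₙ = n! Hₙ`. For a unit
vector `φ` it is the value at `φ^{⊗n}` of the multiple integral of order `n`. -/
noncomputable def hermiteLp (hX : IsIsonormal X) (n : ℕ) (φ : H) : Lp ℝ 2 P :=
  (hX.memLp_eval_hermite n φ).toLp _

theorem coeFn_hermiteLp (hX : IsIsonormal X) (n : ℕ) (φ : H) :
    hX.hermiteLp n φ =ᵐ[P] fun ω => n.factorial * hermitePoly n (X φ ω) := by
  filter_upwards [(hX.memLp_eval_hermite n φ).coeFn_toLp] with ω hω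
  rw [hermiteLp, hω, hermitePoly]
  field_simp

theorem inner_hermiteLp (hX : IsIsonormal X) (n : ℕ) {φ : H} (hφ : ‖φ‖ = 1) (ψ : H) :
    ⟪hX.hermiteLp n φ, hX.hermiteLp n ψ⟫ = n.factorial * ⟪φ, ψ⟫ ^ n := by
  rw [inner_Lp_eq_integral, ← hX.integral_eval_hermite_mul_eval_hermite n hφ ψ]
  refine integral_congr_ae ?_
  filter_upwards [(hX.memLp_eval_hermite n φ).coeFn_toLp,
    (hX.memLp_eval_hermite n ψ).coeFn_toLp] with ω hφω hψω
  rw [hermiteLp, hermiteLp, hφω, hψω]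

end IsIsonormal

end Isonormal

/-! ### Multiple integrals -/

section Tensor

variable {H : Type*} [NormedAddCommGroup H] [InnerProductSpace ℝ H] (n : ℕ)

theorem inner_symPow (φ ψ : H) : ⟪symPow n φ, symPow n ψ⟫ = ⟪φ, ψ⟫ ^ n := by
  refine (UniformSpace.Completion.inner_coe
    (AlgTensorPower.pure _) (AlgTensorPower.pure _)).trans ?_
  change AlgTensorPower.form H n _ _ = _
  simp [AlgTensorPower.form_pure]

theorem symPow_smul (c : ℝ) (φ : H) : symPow n (c • φ) = c ^ n • symPow n φ := by
  refine Subtype.ext ?_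
  have hpure : AlgTensorPower.pure (fun _ : Fin n => c • φ) =
      c ^ n • AlgTensorPower.pure fun _ => φ := by
    have h := (PiTensorProduct.tprod ℝ (s := fun _ : Fin n => H)).map_smul_univ (fun _ => c)
      (fun _ => φ)
    rwa [Fin.prod_const] at h
  exact (congrArg _ hpure).trans (UniformSpace.Completion.coe_smul _ _)

theorem dense_span_range_symPow :
    Dense (Submodule.span ℝ (Set.range (symPow (H := H) n)) : Set (symTensorPower H n)) := by
  have himage : Subtype.val '' (Submodule.span ℝ (Set.range (symPow (H := H) n)) :
      Set (symTensorPower H n)) = Submodule.span ℝ (Set.range (tensorPow (H := H) n)) := by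
    have hmap := Submodule.map_span (symTensorPower H n).subtype (Set.range (symPow (H := H) n))
    rw [← Set.range_comp] at hmap
    exact congrArg SetLike.coe hmap
  intro x
  rw [closure_subtype, himage]
  exact x.2

variable {n}

theorem dense_span_symPow_sphere (hn : n ≠ 0) :
    Dense (Submodule.span ℝ (Set.range fun φ : Metric.sphere (0 : H) 1 => symPow n φ.1) :
      Set (symTensorPower H n)) := by
  refine (dense_span_range_symPow n).mono (Submodule.span_le.2 ?_)
  rintro _ ⟨φ, rfl⟩
  rcases eq_or_ne φ 0 with rfl | hφ
  · have hzero : symPow n (0 : H) = 0 := by simpa [hn] using symPow_smul n (0 : ℝ) (0 : H)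
    exact hzero ▸ Submodule.zero_mem _
  · have hunit : ‖φ‖⁻¹ • φ ∈ Metric.sphere (0 : H) 1 := by
      simpa using norm_smul_inv_norm (𝕜 := ℝ) hφ
    have hsmul : symPow n φ = ‖φ‖ ^ n • symPow n (‖φ‖⁻¹ • φ) := by
      rw [← symPow_smul, smul_inv_smul₀ (norm_ne_zero_iff.2 hφ)]
    rw [hsmul]
    exact Submodule.smul_mem _ _ (Submodule.subset_span ⟨⟨_, hunit⟩, rfl⟩)

end Tensor

theorem exists_continuousLinearMap_of_inner_eq {ι E F : Type*}
    [NormedAddCommGroup E] [InnerProductSpace ℝ E]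
    [NormedAddCommGroup F] [InnerProductSpace ℝ F] [CompleteSpace F]
    {v : ι → E} {w : ι → F} {c : ℝ} (hc : 0 ≤ c)
    (hv : Dense (Submodule.span ℝ (Set.range v) : Set E))
    (h : ∀ i j, ⟪w i, w j⟫ = c * ⟪v i, v j⟫) :
    ∃ J : E →L[ℝ] F, (∀ i, J (v i) = w i) ∧ ∀ x, ‖J x‖ ^ 2 = c * ‖x‖ ^ 2 := by
  set V := Finsupp.linearCombination ℝ v
  set U := Finsupp.linearCombination ℝ w
  have hnorm_sq : ∀ a, ‖U a‖ ^ 2 = c * ‖V a‖ ^ 2 := fun a => by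
    simp only [← real_inner_self_eq_norm_sq, U, V, Finsupp.linearCombination_apply, Finsupp.sum,
      sum_inner, inner_sum, inner_smul_left, inner_smul_right, h, Finset.mul_sum,
      mul_left_comm c]
  have hV : DenseRange V := by
    rwa [DenseRange, ← LinearMap.coe_range, Finsupp.range_linearCombination]
  have hbound : ∃ C : ℝ, ∀ a, ‖U a‖ ≤ C * ‖V a‖ := by
    refine ⟨√c, fun a => le_of_eq ?_⟩
    rw [← Real.sqrt_sq (norm_nonneg (U a)), hnorm_sq, Real.sqrt_mul hc,
      Real.sqrt_sq (norm_nonneg _)]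
  have hextend := LinearMap.extendOfNorm_eq hV hbound
  refine ⟨U.extendOfNorm V, fun i => ?_, fun x => ?_⟩
  · simpa [U, V] using hextend (.single i 1)
  · refine hV.induction_on x (isClosed_eq (by fun_prop) (by fun_prop)) fun a => ?_
    rw [hextend, hnorm_sq]

section MultipleIntegral

variable {Ω : Type*} [MeasurableSpace Ω] {P : Measure Ω}

theorem IsIsonormal.exists_multipleIntegral {H : Type*} [NormedAddCommGroup H]
    [InnerProductSpace ℝ H] {X : H →L[ℝ] Lp ℝ 2 P} (hX : IsIsonormal X) {n : ℕ} (hn : n ≠ 0) :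
    ∃ J : symTensorPower H n →L[ℝ] Lp ℝ 2 P,
      (∀ φ, ‖φ‖ = 1 → J (symPow n φ) = hX.hermiteLp n φ) ∧
        ∀ f, ‖J f‖ ^ 2 = n.factorial * ‖f‖ ^ 2 := by
  obtain ⟨J, hJ, hnorm⟩ := exists_continuousLinearMap_of_inner_eq (c := n.factorial)
    (w := fun φ : Metric.sphere (0 : H) 1 => hX.hermiteLp n φ.1) (by positivity)
    (dense_span_symPow_sphere hn) fun φ ψ => by
      rw [hX.inner_hermiteLp n (norm_eq_of_mem_sphere φ), inner_symPow]
  exact ⟨J, fun φ hφ => hJ ⟨φ, mem_sphere_zero_iff_norm.2 hφ⟩, hnorm⟩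

variable {α β : ℝ} {W : I × I → Ω → ℝ} (hW : IsFractionalBrownianSheet α β W P)

namespace StepSpace

theorem coeFn_integral (f : StepSpace hW) :
    integral hW f =ᵐ[P] fun ω =>
      ∑ p ∈ ((of hW).symm f).support, (of hW).symm f p * W p ω := by
  set a := (of hW).symm f
  have hterm : ∀ᵐ ω ∂P, ∀ p ∈ a.support,
      (a p • (hW.memLp p).toLp (W p) : Lp ℝ 2 P) ω = a p * W p ω := by
    refine (Finset.eventually_all _).2 fun p _ => ?_
    filter_upwards [Lp.coeFn_smul (a p) ((hW.memLp p).toLp (W p)), (hW.memLp p).coeFn_toLp]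
      with ω hsmul htoLp
    rw [hsmul, Pi.smul_apply, htoLp, smul_eq_mul]
  refine (Lp.coeFn_finsetSum a.support fun p => a p • (hW.memLp p).toLp (W p)).trans ?_
  filter_upwards [hterm] with ω hω
  rw [Finset.sum_apply]
  exact Finset.sum_congr rfl hω

theorem hasGaussianLaw_integral (f : StepSpace hW) : HasGaussianLaw (integral hW f) P := by
  let a := (of hW).symm f
  refine ((hW.gaussian.hasGaussianLaw a.support).map_fun
    (∑ p, a p.1 • ContinuousLinearMap.proj p)).congr ?_
  filter_upwards [coeFn_integral hW f] with ω hω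
  simp only [hω, sum_apply, smul_apply, ContinuousLinearMap.proj_apply, Finset.restrict_def,
    smul_eq_mul]
  exact Finset.sum_coe_sort a.support fun p => a p * W p ω

theorem integral_integral_eq_zero (f : StepSpace hW) : ∫ ω, integral hW f ω ∂P = 0 := by
  have := hW.gaussian.isProbabilityMeasure
  rw [integral_congr_ae (coeFn_integral hW f), integral_finsetSum]
  · simp [integral_const_mul, hW.centered]
  · exact fun p _ => ((hW.memLp p).integrable one_le_two).const_mul _

theorem hasLaw_integral (f : StepSpace hW) :
    HasLaw (integral hW f) (gaussianReal 0 (‖f‖₊ ^ 2)) P := by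
  have hnorm : ‖integral hW f‖₊ = ‖f‖₊ := (integralIsometry hW).nnnorm_map f
  simpa only [hnorm] using hasLaw_gaussianReal_of_integral_eq_zero (hasGaussianLaw_integral hW f)
    (integral_integral_eq_zero hW f)

end StepSpace

theorem wiener_coe (f : StepSpace hW) :
    wiener hW (f : CanonicalSpace hW) = StepSpace.integral hW f :=
  ContinuousLinearMap.extend_eq (StepSpace.integralIsometry hW).toContinuousLinearMap
    (e := UniformSpace.Completion.toComplL) UniformSpace.Completion.denseRange_coe
    (UniformSpace.Completion.isUniformInducing_coe _) f

theorem isIsonormal_wiener : IsIsonormal (wiener hW) := by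
  have := hW.gaussian.isProbabilityMeasure
  refine .of_dense UniformSpace.Completion.denseRange_coe ?_
  rintro _ ⟨f, rfl⟩
  rw [wiener_coe, UniformSpace.Completion.nnnorm_coe]
  exact StepSpace.hasLaw_integral hW f

variable {q : ℕ}

theorem exists_isMultipleIntegral (hq : q ≠ 0) : ∃ J, IsMultipleIntegral hW q J := by
  obtain ⟨J, hJ, hnorm⟩ := (isIsonormal_wiener hW).exists_multipleIntegral hq
  refine ⟨J, fun φ hφ => ?_, hnorm⟩
  rw [hJ φ hφ]
  exact (isIsonormal_wiener hW).coeFn_hermiteLp q φ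

theorem isMultipleIntegral_multipleIntegral (hq : q ≠ 0) :
    IsMultipleIntegral hW q (multipleIntegral hW q) := by
  rw [multipleIntegral, dif_pos (exists_isMultipleIntegral hW hq)]
  exact (exists_isMultipleIntegral hW hq).choose_spec

variable {hW} {J J' : symTensorPower (CanonicalSpace hW) q →L[ℝ] Lp ℝ 2 P}

theorem IsMultipleIntegral.unique (hq : q ≠ 0) (hJ : IsMultipleIntegral hW q J)
    (hJ' : IsMultipleIntegral hW q J') : J = J' := by
  refine ContinuousLinearMap.ext_on (dense_span_symPow_sphere hq) ?_
  rintro _ ⟨φ, rfl⟩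
  have hφ : ‖φ.1‖ = 1 := norm_eq_of_mem_sphere φ
  refine Lp.ext ?_
  filter_upwards [hJ.map_symPow φ hφ, hJ'.map_symPow φ hφ] with ω hω hω'
  rw [hω, hω']

theorem existsUnique_isMultipleIntegral (hq : q ≠ 0) : ∃! J, IsMultipleIntegral hW q J :=
  existsUnique_of_exists_of_unique (exists_isMultipleIntegral hW hq) fun _ _ hJ hJ' =>
    hJ.unique hq hJ'

theorem IsMultipleIntegral.map_symPow_of_ne_zero (hJ : IsMultipleIntegral hW q J)
    {φ : CanonicalSpace hW} (hφ : φ ≠ 0) :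
    ∀ᵐ ω ∂P, J (symPow q φ) ω =
      q.factorial * (‖φ‖ ^ q * hermitePoly q (‖φ‖⁻¹ * wiener hW φ ω)) := by
  have hunit : ‖‖φ‖⁻¹ • φ‖ = 1 := by simpa using norm_smul_inv_norm (𝕜 := ℝ) hφ
  have hsmul : J (symPow q φ) = ‖φ‖ ^ q • J (symPow q (‖φ‖⁻¹ • φ)) := by
    rw [← map_smul, ← symPow_smul, smul_inv_smul₀ (norm_ne_zero_iff.2 hφ)]
  rw [hsmul]
  filter_upwards [hJ.map_symPow _ hunit, Lp.coeFn_smul (‖φ‖ ^ q) (J (symPow q (‖φ‖⁻¹ • φ))),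
    Lp.coeFn_smul ‖φ‖⁻¹ (wiener hW φ)] with ω hmap hpow hinv
  rw [hpow, Pi.smul_apply, hmap, map_smul, hinv, Pi.smul_apply, smul_eq_mul, smul_eq_mul]
  ring

end MultipleIntegral

/-! ### Increments of the fractional Brownian motion -/

section SignedRpow

/-- The odd power function `sign(x) |x| ^ r`: up to constants, the derivative of `|x| ^ (r + 1)`
and a primitive of `|x| ^ (r - 1)`. The factor `x` gives it the value `0` at `0`. -/
noncomputable def signedRpow (r x : ℝ) : ℝ := |x| ^ (r - 1) * x

theorem signedRpow_neg (r x : ℝ) : signedRpow r (-x) = -signedRpow r x := by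
  rw [signedRpow, signedRpow, abs_neg, mul_neg]

variable {r x y : ℝ}

theorem signedRpow_of_nonneg (hr : r ≠ 0) (hx : 0 ≤ x) : signedRpow r x = x ^ r := by
  rcases hx.eq_or_lt with rfl | hx
  · rw [signedRpow, mul_zero, Real.zero_rpow hr]
  · rw [signedRpow, abs_of_pos hx, ← Real.rpow_add_one hx.ne', sub_add_cancel]

theorem abs_signedRpow (hr : r ≠ 0) (x : ℝ) : |signedRpow r x| = |x| ^ r := by
  rw [← signedRpow_of_nonneg hr (abs_nonneg x), signedRpow, signedRpow, abs_mul, abs_abs,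
    abs_of_nonneg (Real.rpow_nonneg (abs_nonneg x) _)]

theorem hasDerivAt_signedRpow (r : ℝ) (hx : x ≠ 0) :
    HasDerivAt (signedRpow r) (r * |x| ^ (r - 1)) x := by
  have hpow : |x| ^ (r - 1) = |x| ^ (r - 1 - 1) * |x| := by
    rw [← Real.rpow_add_one (abs_ne_zero.2 hx), sub_add_cancel]
  refine (((hasDerivAt_abs hx).rpow_const (p := r - 1) (Or.inl (abs_ne_zero.2 hx))).mul
    (hasDerivAt_id x)).congr_deriv ?_
  simp only [id, mul_one]
  rw [hpow]
  linear_combination ((r - 1) * |x| ^ (r - 1 - 1)) * sign_mul_self x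

theorem abs_signedRpow_sub_le_of_nonneg (hr : 0 < r) (hr1 : r ≤ 1) (hy : 0 ≤ y) (hyx : y ≤ x) :
    |signedRpow r x - signedRpow r y| ≤ |x - y| ^ r := by
  have hsub := Real.rpow_add_le_add_rpow (sub_nonneg.2 hyx) hy hr.le hr1
  rw [sub_add_cancel] at hsub
  rw [signedRpow_of_nonneg hr.ne' (hy.trans hyx), signedRpow_of_nonneg hr.ne' hy,
    abs_of_nonneg (sub_nonneg.2 (Real.rpow_le_rpow hy hyx hr.le)), abs_of_nonneg (sub_nonneg.2 hyx)]
  linarith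

theorem abs_signedRpow_sub_le (hr : 0 < r) (hr1 : r ≤ 1) (x y : ℝ) :
    |signedRpow r x - signedRpow r y| ≤ 2 * |x - y| ^ r := by
  wlog hyx : y ≤ x generalizing x y
  · rw [abs_sub_comm, abs_sub_comm x]
    exact this y x (le_of_not_ge hyx)
  have hnonneg : 0 ≤ |x - y| ^ r := Real.rpow_nonneg (abs_nonneg _) _
  rcases le_total 0 y with hy | hy
  · linarith [abs_signedRpow_sub_le_of_nonneg hr hr1 hy hyx]
  rcases le_total x 0 with hx | hx
  · have h := abs_signedRpow_sub_le_of_nonneg hr hr1 (neg_nonneg.2 hx) (neg_le_neg hyx)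
    rw [signedRpow_neg, signedRpow_neg, neg_sub_neg, neg_sub_neg] at h
    linarith
  · have hle : ∀ z, |z| ≤ x - y → |z| ^ r ≤ |x - y| ^ r := fun z hz =>
      Real.rpow_le_rpow (abs_nonneg z) (hz.trans (le_abs_self _)) hr.le
    have hx' := hle x (by rw [abs_of_nonneg hx]; linarith)
    have hy' := hle y (by rw [abs_of_nonpos hy]; linarith)
    calc |signedRpow r x - signedRpow r y|
        ≤ |signedRpow r x| + |signedRpow r y| := abs_sub _ _
      _ = |x| ^ r + |y| ^ r := by rw [abs_signedRpow hr.ne', abs_signedRpow hr.ne']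
      _ ≤ 2 * |x - y| ^ r := by linarith

theorem rpow_le_mul_rpow_of_le_mul {C : ℝ} (hr : -1 ≤ r) (hr0 : r ≤ 0) (hC : 1 ≤ C) (hx : 0 < x)
    (hxy : x ≤ C * y) : y ^ r ≤ C * x ^ r := by
  have hC0 : 0 < C := by linarith
  calc y ^ r ≤ (x / C) ^ r :=
        Real.rpow_le_rpow_of_nonpos (div_pos hx hC0) (by rwa [div_le_iff₀' hC0]) hr0
    _ = C ^ (-r) * x ^ r := by
        rw [Real.div_rpow hx.le hC0.le, div_eq_mul_inv, ← Real.rpow_neg hC0.le, mul_comm]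
    _ ≤ C ^ (1 : ℝ) * x ^ r := by gcongr; linarith
    _ = C * x ^ r := by rw [Real.rpow_one]

end SignedRpow

/-- Covariance of the increments over `[s, s']` and `[t, t']` of the fractional Brownian motion. -/
noncomputable def incrCov (γ s s' t t' : ℝ) : ℝ :=
  fbmCov γ s' t' - fbmCov γ s t' - fbmCov γ s' t + fbmCov γ s t

theorem incrCov_comm (γ s s' t t' : ℝ) : incrCov γ s s' t t' = incrCov γ t t' s s' := by
  have hcomm : ∀ x y, fbmCov γ x y = fbmCov γ y x := fun x y => by
    rw [fbmCov, fbmCov, abs_sub_comm, add_comm (x ^ _)]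
  rw [incrCov, incrCov, hcomm s' t', hcomm s t', hcomm s' t, hcomm s t]
  ring

theorem incrCov_eq (γ s s' t t' : ℝ) : incrCov γ s s' t t' =
    (|s' - t| ^ (2 * γ) - |s' - t'| ^ (2 * γ)) / 2 -
      (|s - t| ^ (2 * γ) - |s - t'| ^ (2 * γ)) / 2 := by
  simp only [incrCov, fbmCov]
  ring

theorem incrCov_self {γ : ℝ} (hγ : γ ≠ 0) (s s' : ℝ) :
    incrCov γ s s' s s' = |s' - s| ^ (2 * γ) := by
  rw [incrCov_eq, sub_self, sub_self, abs_zero, Real.zero_rpow (by simpa), abs_sub_comm s]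
  ring

section MeanValue

variable {γ s s' t t' : ℝ}

theorem exists_incrCov_eq_signedRpow (hγ : 1 / 2 < γ) (hs : s < s') (t t' : ℝ) :
    ∃ ξ ∈ Set.Ioo s s', incrCov γ s s' t t' =
      (s' - s) * (γ * (signedRpow (2 * γ - 1) (ξ - t) - signedRpow (2 * γ - 1) (ξ - t'))) := by
  have hderiv : ∀ c x : ℝ, HasDerivAt (fun x => |x - c| ^ (2 * γ))
      (2 * γ * signedRpow (2 * γ - 1) (x - c)) x := fun c x => by
    have h := (hasDerivAt_abs_rpow (x - c) (by linarith : 1 < 2 * γ)).comp_sub_const x c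
    rwa [mul_assoc, show 2 * γ - 2 = 2 * γ - 1 - 1 by ring] at h
  have hF := fun x => ((hderiv t x).sub (hderiv t' x)).div_const 2
  obtain ⟨ξ, hξ, hslope⟩ := exists_hasDerivAt_eq_slope _ _ hs
    (fun x _ => (hF x).continuousAt.continuousWithinAt) fun x _ => hF x
  rw [eq_div_iff (sub_pos.2 hs).ne'] at hslope
  refine ⟨ξ, hξ, ?_⟩
  rw [incrCov_eq]
  simp only [Pi.sub_apply] at hslope
  linear_combination -hslope

theorem exists_incrCov_eq_of_disjoint (hγ : 1 / 2 < γ) (hs : s < s') (ht : t < t')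
    (hdisj : t' < s ∨ s' < t) :
    ∃ η ∈ Set.Ioo (s - t') (s' - t), incrCov γ s s' t t' =
      (s' - s) * (t' - t) * (γ * (2 * γ - 1) * |η| ^ (2 * γ - 2)) := by
  obtain ⟨ξ, hξ, hincr⟩ := exists_incrCov_eq_signedRpow hγ hs t t'
  have hderiv : ∀ x ∈ Set.Icc (ξ - t') (ξ - t), HasDerivAt (signedRpow (2 * γ - 1))
      ((2 * γ - 1) * |x| ^ (2 * γ - 1 - 1)) x := by
    refine fun x hx => hasDerivAt_signedRpow _ ?_
    rintro rfl
    rcases hdisj with h | h <;> linarith [hξ.1, hξ.2, hx.1, hx.2]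
  obtain ⟨η, hη, hslope⟩ := exists_hasDerivAt_eq_slope _ _ (sub_lt_sub_left ht ξ)
    (fun x hx => (hderiv x hx).continuousAt.continuousWithinAt)
    fun x hx => hderiv x (Set.Ioo_subset_Icc_self hx)
  rw [sub_sub_sub_cancel_left, eq_div_iff (sub_pos.2 ht).ne',
    show 2 * γ - 1 - 1 = 2 * γ - 2 by ring] at hslope
  refine ⟨η, ⟨by linarith [hξ.1, hη.1], by linarith [hξ.2, hη.2]⟩, ?_⟩
  rw [hincr, ← hslope]
  ring

variable {u v : ℝ}

theorem abs_incrCov_le_of_abs_sub_le (hγ : 1 / 2 < γ) (hγ1 : γ ≤ 1) (hs : s < s') (ht : t < t')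
    (huv : u ≠ v) (hnear : |u - v| ≤ 4 * (t' - t)) :
    |incrCov γ s s' t t'| ≤ (s' - s) * (t' - t) * (8 * |u - v| ^ (2 * γ - 2)) := by
  have ht' : 0 < t' - t := sub_pos.2 ht
  have hs' : 0 < s' - s := sub_pos.2 hs
  obtain ⟨ξ, -, hincr⟩ := exists_incrCov_eq_signedRpow hγ hs t t'
  have hholder := abs_signedRpow_sub_le (r := 2 * γ - 1) (by linarith) (by linarith)
    (ξ - t) (ξ - t')
  rw [sub_sub_sub_cancel_left, abs_of_pos ht'] at hholder
  have hpow : (t' - t) ^ (2 * γ - 1) = (t' - t) * (t' - t) ^ (2 * γ - 2) := by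
    rw [mul_comm (t' - t), ← Real.rpow_add_one ht'.ne']
    congr 1
    ring
  have hmesh : (t' - t) ^ (2 * γ - 2) ≤ 4 * |u - v| ^ (2 * γ - 2) :=
    rpow_le_mul_rpow_of_le_mul (by linarith) (by linarith) (by norm_num)
      (abs_pos.2 (sub_ne_zero.2 huv)) hnear
  rw [hincr, abs_mul, abs_of_pos hs', abs_mul, abs_of_pos (by linarith : 0 < γ), mul_assoc]
  refine mul_le_mul_of_nonneg_left ?_ hs'.le
  calc γ * |signedRpow (2 * γ - 1) (ξ - t) - signedRpow (2 * γ - 1) (ξ - t')|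
      ≤ 1 * (2 * (t' - t) ^ (2 * γ - 1)) := by gcongr
    _ = (t' - t) * (2 * (t' - t) ^ (2 * γ - 2)) := by rw [hpow]; ring
    _ ≤ (t' - t) * (2 * (4 * |u - v| ^ (2 * γ - 2))) := by gcongr
    _ = (t' - t) * (8 * |u - v| ^ (2 * γ - 2)) := by ring

theorem abs_incrCov_le_of_lt_abs_sub (hγ : 1 / 2 < γ) (hγ1 : γ ≤ 1) (hle : s' - s ≤ t' - t)
    (hu : u ∈ Set.Ico s s') (hv : v ∈ Set.Ico t t') (hfar : 4 * (t' - t) < |u - v|) :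
    |incrCov γ s s' t t'| ≤ (s' - s) * (t' - t) * (8 * |u - v| ^ (2 * γ - 2)) := by
  have hs : s < s' := hu.1.trans_lt hu.2
  have ht : t < t' := hv.1.trans_lt hv.2
  have hdisj : t' < s ∨ s' < t := by
    rcases lt_abs.1 hfar with h | h
    · left; linarith [hu.2, hv.1]
    · right; linarith [hu.1, hv.2]
  obtain ⟨η, hη, hincr⟩ := exists_incrCov_eq_of_disjoint hγ hs ht hdisj
  have hη2 : |u - v| ≤ 2 * |η| := by
    have hclose : |(u - v) - η| ≤ 2 * (t' - t) := by
      rw [abs_le]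
      constructor <;> linarith [hη.1, hη.2, hu.1, hu.2, hv.1, hv.2]
    linarith [abs_sub_abs_le_abs_sub (u - v) η]
  have hpow : |η| ^ (2 * γ - 2) ≤ 2 * |u - v| ^ (2 * γ - 2) :=
    rpow_le_mul_rpow_of_le_mul (by linarith) (by linarith) (by norm_num) (by linarith) hη2
  have harea : 0 ≤ (s' - s) * (t' - t) := (mul_pos (sub_pos.2 hs) (sub_pos.2 ht)).le
  have hc0 : 0 ≤ γ * (2 * γ - 1) := mul_nonneg (by linarith) (by linarith)
  have hc1 : γ * (2 * γ - 1) ≤ 1 := mul_le_one₀ hγ1 (by linarith) (by linarith)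
  rw [hincr, abs_of_nonneg (mul_nonneg harea (mul_nonneg hc0 (by positivity)))]
  refine mul_le_mul_of_nonneg_left ?_ harea
  calc γ * (2 * γ - 1) * |η| ^ (2 * γ - 2) ≤ 1 * (2 * |u - v| ^ (2 * γ - 2)) := by gcongr
    _ ≤ 8 * |u - v| ^ (2 * γ - 2) := by
        linarith [Real.rpow_nonneg (abs_nonneg (u - v)) (2 * γ - 2)]

theorem abs_incrCov_le (hγ : 1 / 2 < γ) (hγ1 : γ ≤ 1) (hu : u ∈ Set.Ico s s')
    (hv : v ∈ Set.Ico t t') (huv : u ≠ v) :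
    |incrCov γ s s' t t'| ≤ (s' - s) * (t' - t) * (8 * |u - v| ^ (2 * γ - 2)) := by
  wlog hle : s' - s ≤ t' - t generalizing s s' t t' u v
  · rw [incrCov_comm, abs_sub_comm, mul_comm (s' - s)]
    exact this hv hu huv.symm (le_of_not_ge hle)
  rcases le_or_gt |u - v| (4 * (t' - t)) with hnear | hfar
  · exact abs_incrCov_le_of_abs_sub_le hγ hγ1 (hu.1.trans_lt hu.2) (hv.1.trans_lt hv.2) huv hnear
  · exact abs_incrCov_le_of_lt_abs_sub hγ hγ1 hle hu hv hfar

end MeanValue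

/-! ### Riemann sums of powers of increment covariances -/

theorem tendsto_fst_atTop : Tendsto (Prod.fst : ℕ × ℕ → ℕ) atTop atTop := by
  rw [← prod_atTop_atTop_eq]
  exact tendsto_fst

theorem tendsto_snd_atTop : Tendsto (Prod.snd : ℕ × ℕ → ℕ) atTop atTop := by
  rw [← prod_atTop_atTop_eq]
  exact tendsto_snd

theorem eventually_pos_and_pos : ∀ᶠ p : ℕ × ℕ in atTop, 0 < p.1 ∧ 0 < p.2 :=
  (tendsto_fst_atTop.eventually_gt_atTop 0).and (tendsto_snd_atTop.eventually_gt_atTop 0)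

/-- The cell `[i/N, (i+1)/N)` of the grid of mesh `1/N`. -/
def gridCell (N i : ℕ) : Set ℝ := Set.Ico ((i : ℝ) / N) (((i + 1 : ℕ) : ℝ) / N)

/-- Covariance of the `i`-th and `j`-th increments of the fractional Brownian motion on the grids
of mesh `1/N` and `1/M`. -/
noncomputable def gridCov (γ : ℝ) (N M i j : ℕ) : ℝ :=
  incrCov γ (i / N) (((i + 1 : ℕ) : ℝ) / N) (j / M) (((j + 1 : ℕ) : ℝ) / M)

section Grid

variable {N M : ℕ}

theorem natCast_succ_div_sub (N i : ℕ) : ((i + 1 : ℕ) : ℝ) / N - i / N = 1 / N := by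
  rw [← sub_div, Nat.cast_succ, add_sub_cancel_left]

theorem mem_gridCell_iff (hN : 0 < N) {u : ℝ} {i : ℕ} :
    u ∈ gridCell N i ↔ 0 ≤ u ∧ ⌊N * u⌋₊ = i := by
  have hN' : (0 : ℝ) < N := Nat.cast_pos.2 hN
  rw [gridCell, Set.mem_Ico, div_le_iff₀' hN', lt_div_iff₀' hN', Nat.cast_succ]
  constructor
  · intro h
    have hu : 0 ≤ N * u := i.cast_nonneg.trans h.1
    exact ⟨nonneg_of_mul_nonneg_right hu hN', (Nat.floor_eq_iff hu).2 h⟩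
  · rintro ⟨hu, hi⟩
    exact (Nat.floor_eq_iff (by positivity)).1 hi

theorem mem_gridCell_floor (hN : 0 < N) {u : ℝ} (hu : 0 ≤ u) : u ∈ gridCell N ⌊N * u⌋₊ :=
  (mem_gridCell_iff hN).2 ⟨hu, rfl⟩

theorem disjoint_gridCell (hN : 0 < N) {i j : ℕ} (hij : i ≠ j) :
    Disjoint (gridCell N i) (gridCell N j) := by
  rw [Set.disjoint_left]
  intro u hi hj
  rw [mem_gridCell_iff hN] at hi hj
  exact hij (hi.2.symm.trans hj.2)

theorem volume_gridCell (N i : ℕ) : volume (gridCell N i) = ENNReal.ofReal (1 / N) := by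
  rw [gridCell, Real.volume_Ico, natCast_succ_div_sub]

theorem Ico_natCast_div_eq_biUnion_gridCell (hN : 0 < N) (a : ℕ) :
    Set.Ico 0 ((a : ℝ) / N) = ⋃ i ∈ Finset.range a, gridCell N i := by
  have hN' : (0 : ℝ) < N := Nat.cast_pos.2 hN
  ext u
  simp only [Set.mem_iUnion, mem_gridCell_iff hN, Finset.mem_range, Set.mem_Ico,
    lt_div_iff₀' hN', exists_prop]
  constructor
  · rintro ⟨hu, hua⟩
    exact ⟨_, (Nat.floor_lt (by positivity)).2 hua, hu, rfl⟩
  · rintro ⟨i, hia, hu, rfl⟩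
    exact ⟨hu, (Nat.floor_lt (by positivity)).1 hia⟩

theorem setIntegral_floor_floor (hN : 0 < N) (hM : 0 < M) (a b : ℕ) (g : ℕ → ℕ → ℝ) :
    ∫ z in Set.Ico 0 ((a : ℝ) / N) ×ˢ Set.Ico 0 ((b : ℝ) / M), g ⌊N * z.1⌋₊ ⌊M * z.2⌋₊ =
      ((N : ℝ) * M)⁻¹ * ∑ i ∈ Finset.range a, ∑ j ∈ Finset.range b, g i j := by
  have hmeas : ∀ p : ℕ × ℕ, MeasurableSet (gridCell N p.1 ×ˢ gridCell M p.2) := fun p =>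
    measurableSet_Ico.prod measurableSet_Ico
  have hvol : ∀ p : ℕ × ℕ, volume (gridCell N p.1 ×ˢ gridCell M p.2) =
      ENNReal.ofReal (1 / N) * ENNReal.ofReal (1 / M) := fun p => by
    rw [Measure.volume_eq_prod, Measure.prod_prod, volume_gridCell, volume_gridCell]
  have hconst : ∀ p : ℕ × ℕ, Set.EqOn (fun z : ℝ × ℝ => g ⌊N * z.1⌋₊ ⌊M * z.2⌋₊)
      (fun _ => g p.1 p.2) (gridCell N p.1 ×ˢ gridCell M p.2) := by
    rintro p z ⟨h1, h2⟩
    rw [mem_gridCell_iff hN] at h1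
    rw [mem_gridCell_iff hM] at h2
    simp only [h1.2, h2.2]
  have hunion : Set.Ico 0 ((a : ℝ) / N) ×ˢ Set.Ico 0 ((b : ℝ) / M) =
      ⋃ p ∈ Finset.range a ×ˢ Finset.range b, gridCell N p.1 ×ˢ gridCell M p.2 := by
    rw [Ico_natCast_div_eq_biUnion_gridCell hN, Ico_natCast_div_eq_biUnion_gridCell hM]
    ext z
    simp only [Set.mem_prod, Set.mem_iUnion, Finset.mem_product, exists_prop, Prod.exists]
    tauto
  have hcell : ∀ p : ℕ × ℕ, ∫ z in gridCell N p.1 ×ˢ gridCell M p.2, g ⌊N * z.1⌋₊ ⌊M * z.2⌋₊ =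
      ((N : ℝ) * M)⁻¹ * g p.1 p.2 := fun p => by
    rw [setIntegral_congr_fun (hmeas p) (hconst p), setIntegral_const, Measure.real, hvol,
      ENNReal.toReal_mul, ENNReal.toReal_ofReal (by positivity),
      ENNReal.toReal_ofReal (by positivity), smul_eq_mul, mul_inv, one_div, one_div]
  rw [hunion, integral_biUnion_finset _ fun p _ => hmeas p]
  · simp only [hcell, ← Finset.mul_sum, Finset.sum_product]
  · intro p _ r _ hpr
    rw [Function.onFun, Set.disjoint_prod]
    rcases not_and_or.1 (mt Prod.ext_iff.2 hpr) with h | h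
    exacts [Or.inl (disjoint_gridCell hN h), Or.inr (disjoint_gridCell hM h)]
  · refine fun p _ => (integrableOn_const ?_).congr_fun (hconst p).symm (hmeas p)
    rw [hvol]
    exact ENNReal.mul_ne_top ENNReal.ofReal_ne_top ENNReal.ofReal_ne_top

end Grid

/-- The covariance density of the increments over the cells that contain `u` and `v`, on the grids
of mesh `1/N` and `1/M`: the step function which approximates `fbmDensity`. -/
noncomputable def gridDensity (γ : ℝ) (N M : ℕ) (u v : ℝ) : ℝ :=
  N * M * gridCov γ N M ⌊N * u⌋₊ ⌊M * v⌋₊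

/-- The density `γ (2γ - 1) |u - v| ^ (2γ - 2)` of the covariance of the increments of the
fractional Brownian motion. It takes a junk value on the diagonal. -/
noncomputable def fbmDensity (γ u v : ℝ) : ℝ := γ * (2 * γ - 1) * |u - v| ^ (2 * γ - 2)

section Density

variable {γ u v : ℝ}

theorem abs_gridDensity_le (hγ : 1 / 2 < γ) (hγ1 : γ ≤ 1) {N M : ℕ} (hN : 0 < N) (hM : 0 < M)
    (hu : 0 ≤ u) (hv : 0 ≤ v) (huv : u ≠ v) :
    |gridDensity γ N M u v| ≤ 8 * |u - v| ^ (2 * γ - 2) := by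
  have hN' : (0 : ℝ) < N := Nat.cast_pos.2 hN
  have hM' : (0 : ℝ) < M := Nat.cast_pos.2 hM
  have hincr := abs_incrCov_le hγ hγ1 (mem_gridCell_floor hN hu) (mem_gridCell_floor hM hv) huv
  rw [natCast_succ_div_sub, natCast_succ_div_sub] at hincr
  rw [gridDensity, gridCov, abs_mul, abs_of_pos (mul_pos hN' hM')]
  calc N * M * _ ≤ N * M * (1 / N * (1 / M) * (8 * |u - v| ^ (2 * γ - 2))) := by gcongr
    _ = 8 * |u - v| ^ (2 * γ - 2) := by field_simp

theorem measurable_gridDensity (γ : ℝ) (N M : ℕ) :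
    Measurable fun z : ℝ × ℝ => gridDensity γ N M z.1 z.2 := by
  have hcov : Measurable fun n : ℕ × ℕ => N * M * gridCov γ N M n.1 n.2 := measurable_of_countable _
  have hfloor : Measurable fun z : ℝ × ℝ => (⌊N * z.1⌋₊, ⌊M * z.2⌋₊) := by fun_prop
  simpa only [gridDensity, Function.comp_def] using hcov.comp hfloor

theorem exists_gridDensity_eq (hγ : 1 / 2 < γ) {N M : ℕ} (hN : 0 < N) (hM : 0 < M)
    (hu : 0 ≤ u) (hv : 0 ≤ v) (hmesh : 1 / (N : ℝ) + 1 / M < |u - v|) :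
    ∃ η : ℝ, |η - (u - v)| < 1 / N + 1 / M ∧
      gridDensity γ N M u v = γ * (2 * γ - 1) * |η| ^ (2 * γ - 2) := by
  have hu' := mem_gridCell_floor hN hu
  have hv' := mem_gridCell_floor hM hv
  have hsN := natCast_succ_div_sub N ⌊N * u⌋₊
  have hsM := natCast_succ_div_sub M ⌊M * v⌋₊
  have hdisj : ((⌊M * v⌋₊ + 1 : ℕ) : ℝ) / M < ⌊N * u⌋₊ / N ∨
      ((⌊N * u⌋₊ + 1 : ℕ) : ℝ) / N < ⌊M * v⌋₊ / M := by
    rcases lt_abs.1 hmesh with h | h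
    · left; linarith [hu'.2, hv'.1]
    · right; linarith [hu'.1, hv'.2]
  obtain ⟨η, hη, hincr⟩ := exists_incrCov_eq_of_disjoint hγ (hu'.1.trans_lt hu'.2)
    (hv'.1.trans_lt hv'.2) hdisj
  refine ⟨η, ?_, ?_⟩
  · rw [abs_lt]
    constructor <;> linarith [hη.1, hη.2, hu'.1, hu'.2, hv'.1, hv'.2]
  · rw [gridDensity, gridCov, hincr, hsN, hsM]
    field_simp

theorem tendsto_gridDensity (hγ : 1 / 2 < γ) (hu : 0 ≤ u) (hv : 0 ≤ v) (huv : u ≠ v) :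
    Tendsto (fun p : ℕ × ℕ => gridDensity γ p.1 p.2 u v) atTop (𝓝 (fbmDensity γ u v)) := by
  have hne : u - v ≠ 0 := sub_ne_zero.2 huv
  have hcont : ContinuousAt (fun x : ℝ => γ * (2 * γ - 1) * |x| ^ (2 * γ - 2)) (u - v) :=
    continuousAt_const.mul (continuous_abs.continuousAt.rpow_const (Or.inl (abs_ne_zero.2 hne)))
  have hmesh : Tendsto (fun p : ℕ × ℕ => 1 / (p.1 : ℝ) + 1 / (p.2 : ℝ)) atTop (𝓝 0) := by
    have h := tendsto_one_div_atTop_nhds_zero_nat (𝕜 := ℝ)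
    simpa using (h.comp tendsto_fst_atTop).add (h.comp tendsto_snd_atTop)
  rw [Metric.tendsto_nhds]
  intro ε hε
  obtain ⟨δ, hδ, hδε⟩ := Metric.continuousAt_iff.1 hcont ε hε
  filter_upwards [hmesh.eventually_lt_const hδ, hmesh.eventually_lt_const (abs_pos.2 hne),
    eventually_pos_and_pos] with p hpδ hpuv ⟨hp1, hp2⟩
  obtain ⟨η, hη, hdensity⟩ := exists_gridDensity_eq hγ hp1 hp2 hu hv hpuv
  rw [hdensity]
  exact hδε (hη.trans hpδ)

theorem integrableOn_abs_sub_rpow {r : ℝ} (hr : -1 < r) :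
    IntegrableOn (fun z : ℝ × ℝ => |z.1 - z.2| ^ r) (Set.Ico 0 1 ×ˢ Set.Ico 0 1) := by
  have hloc : LocallyIntegrable (fun w : ℝ => |w| ^ r) volume := by
    refine locallyIntegrable_of_norm_le_rpow (C := 1) (α := -r) (by simp) (by simp; linarith)
      (ae_of_all _ fun x => ?_)
      (continuous_abs.measurable.pow_const r).aestronglyMeasurable
    rw [neg_neg, one_mul, Real.norm_eq_abs, Real.norm_eq_abs,
      abs_of_nonneg (Real.rpow_nonneg (abs_nonneg x) r)]
  have hdiff : Integrable ((Set.Icc (-1 : ℝ) 1).indicator fun w => |w| ^ r) :=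
    (hloc.integrableOn_isCompact isCompact_Icc).integrable_indicator measurableSet_Icc
  have hunit : Integrable ((Set.Icc (0 : ℝ) 1).indicator fun _ => (1 : ℝ)) :=
    (integrableOn_const (by simp)).integrable_indicator measurableSet_Icc
  refine ((measurePreserving_sub_prod (volume : Measure ℝ)
    (volume : Measure ℝ)).integrable_comp_of_integrable
      (hdiff.mul_prod hunit)).integrableOn.congr_fun ?_ (measurableSet_Ico.prod measurableSet_Ico)
  rintro z ⟨⟨hu, hu1⟩, hv, hv1⟩
  have h1 : z.1 - z.2 ∈ Set.Icc (-1 : ℝ) 1 := ⟨by linarith, by linarith⟩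
  have h2 : z.2 ∈ Set.Icc (0 : ℝ) 1 := ⟨hv, hv1.le⟩
  simp [h1, h2]

end Density

section RiemannSum

variable {γ t : ℝ} {q : ℕ}

theorem ae_ne_and_ne_and_ne (t : ℝ) : ∀ᵐ z : ℝ × ℝ, z.1 ≠ z.2 ∧ z.1 ≠ t ∧ z.2 ≠ t := by
  have hne : ∀ c : ℝ, ∀ᵐ x : ℝ, x ≠ c := fun c => by simp [ae_iff]
  have hfst : Measure.QuasiMeasurePreserving (Prod.fst : ℝ × ℝ → ℝ) :=
    Measure.quasiMeasurePreserving_fst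
  have hsnd : Measure.QuasiMeasurePreserving (Prod.snd : ℝ × ℝ → ℝ) :=
    Measure.quasiMeasurePreserving_snd
  have hsub := hfst.comp (measurePreserving_sub_prod (volume : Measure ℝ)
    (volume : Measure ℝ)).quasiMeasurePreserving
  filter_upwards [hsub.ae (hne 0), hfst.ae (hne t), hsnd.ae (hne t)] with z hz hz1 hz2
  exact ⟨sub_ne_zero.1 hz, hz1, hz2⟩

theorem eventually_mem_Ico_iff {ι : Type*} {l : Filter ι} {b : ι → ℝ} {u : ℝ}
    (hb : Tendsto b l (𝓝 t)) (hut : u ≠ t) :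
    ∀ᶠ i in l, u ∈ Set.Ico 0 (b i) ↔ u ∈ Set.Ico 0 t := by
  rcases hut.lt_or_gt with hlt | hgt
  · filter_upwards [hb.eventually_const_lt hlt] with i hi
    simp only [Set.mem_Ico, hi, hlt]
  · filter_upwards [hb.eventually_lt_const hgt] with i hi
    simp only [Set.mem_Ico, hi.not_gt, hgt.not_gt]

theorem tendsto_indicator_gridDensity_pow (hγ : 1 / 2 < γ) {b : ℕ → ℝ}
    (hb : Tendsto b atTop (𝓝 t)) {z : ℝ × ℝ} (hz : z.1 ≠ z.2 ∧ z.1 ≠ t ∧ z.2 ≠ t) :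
    Tendsto (fun p : ℕ × ℕ => (Set.Ico 0 (b p.1) ×ˢ Set.Ico 0 (b p.2)).indicator
        (fun z => gridDensity γ p.1 p.2 z.1 z.2 ^ q) z) atTop
      (𝓝 ((Set.Ico 0 t ×ˢ Set.Ico 0 t).indicator (fun z => fbmDensity γ z.1 z.2 ^ q) z)) := by
  have hmem : ∀ᶠ p : ℕ × ℕ in atTop,
      z ∈ Set.Ico 0 (b p.1) ×ˢ Set.Ico 0 (b p.2) ↔ z ∈ Set.Ico 0 t ×ˢ Set.Ico 0 t :=
    ((eventually_mem_Ico_iff (hb.comp tendsto_fst_atTop) hz.2.1).and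
      (eventually_mem_Ico_iff (hb.comp tendsto_snd_atTop) hz.2.2)).mono fun p h =>
        and_congr h.1 h.2
  by_cases hzt : z ∈ Set.Ico 0 t ×ˢ Set.Ico 0 t
  · rw [Set.indicator_of_mem hzt]
    refine ((tendsto_gridDensity hγ hzt.1.1 hzt.2.1 hz.1).pow q).congr' ?_
    filter_upwards [hmem] with p hp
    rw [Set.indicator_of_mem (hp.2 hzt)]
  · rw [Set.indicator_of_notMem hzt]
    refine tendsto_const_nhds.congr' ?_
    filter_upwards [hmem] with p hp
    rw [Set.indicator_of_notMem (mt hp.1 hzt)]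

theorem abs_gridDensity_pow_le (hγ : 1 / 2 < γ) (hγ1 : γ ≤ 1) {N M : ℕ} (hN : 0 < N) (hM : 0 < M)
    {u v : ℝ} (hu : 0 ≤ u) (hv : 0 ≤ v) (huv : u ≠ v) :
    |gridDensity γ N M u v ^ q| ≤ 8 ^ q * |u - v| ^ ((2 * γ - 2) * q) := by
  rw [abs_pow, Real.rpow_mul_natCast (abs_nonneg _), ← mul_pow]
  exact pow_le_pow_left₀ (abs_nonneg _) (abs_gridDensity_le hγ hγ1 hN hM hu hv huv) q

theorem tendsto_setIntegral_gridDensity_pow (hγ : 1 / 2 < γ) (hγ1 : γ ≤ 1)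
    (hr : -1 < (2 * γ - 2) * q) {b : ℕ → ℝ} (hb1 : ∀ᶠ N in atTop, b N ≤ 1)
    (hb : Tendsto b atTop (𝓝 t)) :
    Tendsto (fun p : ℕ × ℕ => ∫ z in Set.Ico 0 (b p.1) ×ˢ Set.Ico 0 (b p.2),
        gridDensity γ p.1 p.2 z.1 z.2 ^ q) atTop
      (𝓝 (∫ z in Set.Ico 0 t ×ˢ Set.Ico 0 t, fbmDensity γ z.1 z.2 ^ q)) := by
  have hmeas : ∀ x y : ℝ, MeasurableSet (Set.Ico 0 x ×ˢ Set.Ico 0 y) := fun x y =>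
    measurableSet_Ico.prod measurableSet_Ico
  simp only [← integral_indicator (hmeas _ _)]
  refine tendsto_integral_filter_of_dominated_convergence
    ((Set.Ico 0 1 ×ˢ Set.Ico 0 1).indicator fun z => 8 ^ q * |z.1 - z.2| ^ ((2 * γ - 2) * q))
    (.of_forall fun p => ?_) ?_
    (IntegrableOn.integrable_indicator ((integrableOn_abs_sub_rpow hr).const_mul _) (hmeas 1 1)) ?_
  · exact (((measurable_gridDensity γ p.1 p.2).pow_const q).indicator
      (hmeas _ _)).aestronglyMeasurable
  · filter_upwards [eventually_pos_and_pos, tendsto_fst_atTop.eventually hb1,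
      tendsto_snd_atTop.eventually hb1] with p ⟨hp1, hp2⟩ hb1 hb2
    filter_upwards [ae_ne_and_ne_and_ne t] with z hz
    rw [norm_indicator_eq_indicator_norm]
    refine Set.indicator_apply_le' (fun hzb => ?_) fun _ =>
      Set.indicator_nonneg (fun _ _ => by positivity) z
    have hz1 : z ∈ Set.Ico 0 1 ×ˢ Set.Ico 0 1 :=
      ⟨⟨hzb.1.1, hzb.1.2.trans_le hb1⟩, hzb.2.1, hzb.2.2.trans_le hb2⟩
    rw [Set.indicator_of_mem hz1]
    exact abs_gridDensity_pow_le hγ hγ1 hp1 hp2 hzb.1.1 hzb.2.1 hz.1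
  · filter_upwards [ae_ne_and_ne_and_ne t] with z hz
    exact tendsto_indicator_gridDensity_pow hγ hb hz

/-- The normalized sum of the `q`-th powers of the covariances of the first `a` increments on the
grid of mesh `1/N` with the first `b` increments on the grid of mesh `1/M`. -/
noncomputable def gridCovPowSum (γ : ℝ) (q N M a b : ℕ) : ℝ :=
  ((N : ℝ) * M) ^ (q - 1) * ∑ i ∈ Finset.range a, ∑ j ∈ Finset.range b, gridCov γ N M i j ^ q

theorem gridCovPowSum_eq_setIntegral (γ : ℝ) (hq : q ≠ 0) {N M : ℕ} (hN : 0 < N) (hM : 0 < M)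
    (a b : ℕ) :
    gridCovPowSum γ q N M a b = ∫ z in Set.Ico 0 ((a : ℝ) / N) ×ˢ Set.Ico 0 ((b : ℝ) / M),
      gridDensity γ N M z.1 z.2 ^ q := by
  have hNM : (N : ℝ) * M ≠ 0 := by positivity
  simp only [gridDensity, gridCovPowSum,
    setIntegral_floor_floor hN hM a b fun i j => (N * M * gridCov γ N M i j) ^ q]
  simp only [mul_pow _ (gridCov _ _ _ _ _), ← Finset.mul_sum]
  rw [← pow_sub_one_mul hq, mul_comm (_ ^ _) (N * M : ℝ), mul_assoc, inv_mul_cancel_left₀ hNM]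

theorem tendsto_gridCovPowSum (hq : q ≠ 0) (hγ1 : γ ≤ 1) (hr : -1 < (2 * γ - 2) * q) {a : ℕ → ℕ}
    (ha : ∀ᶠ N in atTop, a N ≤ N) (hat : Tendsto (fun N => (a N : ℝ) / N) atTop (𝓝 t)) :
    Tendsto (fun p : ℕ × ℕ => gridCovPowSum γ q p.1 p.2 (a p.1) (a p.2)) atTop
      (𝓝 (∫ z in Set.Ico 0 t ×ˢ Set.Ico 0 t, fbmDensity γ z.1 z.2 ^ q)) := by
  have hq1 : (1 : ℝ) ≤ q := Nat.one_le_cast.2 (Nat.one_le_iff_ne_zero.2 hq)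
  have hγ : 1 / 2 < γ := by nlinarith
  have ha1 : ∀ᶠ N in atTop, (a N : ℝ) / N ≤ 1 := ha.mono fun N hN =>
    div_le_one_of_le₀ (Nat.cast_le.2 hN) N.cast_nonneg
  refine (tendsto_setIntegral_gridDensity_pow hγ hγ1 hr ha1 hat).congr' ?_
  filter_upwards [eventually_pos_and_pos] with p hp
  rw [gridCovPowSum_eq_setIntegral γ hq hp.1 hp.2]

end RiemannSum

section NumCells

/-- The number of cells of the grid of mesh `1/N` that enter the kernels up to time `t`. -/
noncomputable def numCells (t : ℝ) (N : ℕ) : ℕ := ⌊((N : ℝ) - 1) * t⌋₊ + 1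

theorem numCells_le {t : ℝ} (ht : t ≤ 1) {N : ℕ} (hN : 0 < N) : numCells t N ≤ N := by
  have hN1 : (1 : ℝ) ≤ N := Nat.one_le_cast.2 hN
  refine (Nat.floor_lt' hN.ne').2 ?_
  nlinarith

theorem numCells_one {N : ℕ} (hN : 0 < N) : numCells 1 N = N := by
  rw [numCells, mul_one, ← Nat.cast_pred hN, Nat.floor_natCast, Nat.sub_add_cancel hN]

theorem tendsto_numCells_div {t : ℝ} (ht : 0 ≤ t) :
    Tendsto (fun N : ℕ => (numCells t N : ℝ) / N) atTop (𝓝 t) := by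
  have hinv := tendsto_one_div_atTop_nhds_zero_nat (𝕜 := ℝ)
  have hlower : Tendsto (fun N : ℕ => t - t * (1 / (N : ℝ))) atTop (𝓝 t) := by
    simpa using (hinv.const_mul t).const_sub t
  have hupper : Tendsto (fun N : ℕ => t + 1 / (N : ℝ)) atTop (𝓝 t) := by
    simpa using hinv.const_add t
  refine tendsto_of_tendsto_of_tendsto_of_le_of_le' hlower hupper ?_ ?_ <;>
    filter_upwards [eventually_gt_atTop 0] with N hN
  all_goals
    have hN1 : (1 : ℝ) ≤ N := Nat.one_le_cast.2 hN
    have hN' : (0 : ℝ) < N := Nat.cast_pos.2 hN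
    rw [numCells, Nat.cast_succ]
  · rw [le_div_iff₀ hN', sub_mul, mul_assoc, one_div_mul_cancel hN'.ne']
    linarith [Nat.lt_floor_add_one (((N : ℝ) - 1) * t)]
  · rw [div_le_iff₀ hN', add_mul, one_div_mul_cancel hN'.ne']
    linarith [Nat.floor_le (mul_nonneg (sub_nonneg.2 hN1) ht)]

end NumCells

/-! ### Cells of the sheet -/

theorem coe_gridPoint {N i : ℕ} (hi : i ≤ N) : (gridPoint N i : ℝ) = i / N := by
  have hmem : (i : ℝ) / N ∈ Set.Icc 0 1 :=
    ⟨by positivity, div_le_one_of_le₀ (Nat.cast_le.2 hi) N.cast_nonneg⟩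
  rw [gridPoint, Set.projIcc_of_mem zero_le_one hmem]

theorem gridCov_self {γ : ℝ} (hγ : γ ≠ 0) (N i : ℕ) :
    gridCov γ N N i i = ((N : ℝ) ^ (-γ)) ^ 2 := by
  rw [gridCov, incrCov_self hγ, natCast_succ_div_sub, abs_of_nonneg (by positivity), one_div,
    Real.inv_rpow N.cast_nonneg, Real.rpow_neg N.cast_nonneg, inv_pow, mul_comm 2 γ]
  exact congrArg _ (Real.rpow_mul_natCast N.cast_nonneg γ 2)

section Cells

variable {Ω : Type*} [MeasurableSpace Ω] {α β : ℝ} {W : I × I → Ω → ℝ} {P : Measure Ω}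
variable (hW : IsFractionalBrownianSheet α β W P)

namespace StepSpace

theorem integral_single (p : I × I) :
    integral hW (of hW (.single p 1)) = (hW.memLp p).toLp (W p) := by
  simp [integral]

theorem inner_single (p r : I × I) :
    ⟪of hW (.single p 1), of hW (.single r 1)⟫ = sheetCov α β p r := by
  change form hW _ _ = _
  simp [form]

theorem inner_rectStep (s s' t t' u u' v v' : I) :
    ⟪of hW (rectStep s s' t t'), of hW (rectStep u u' v v')⟫ =
      incrCov α s s' u u' * incrCov β t t' v v' := by
  simp only [rectStep, map_add, map_sub, inner_add_left, inner_sub_left, inner_add_right,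
    inner_sub_right, inner_single, sheetCov, incrCov]
  ring

end StepSpace

variable {N M N' M' i j i' j' : ℕ}

theorem inner_cell (hi : i < N) (hj : j < M) (hi' : i' < N') (hj' : j' < M') :
    ⟪cell hW N M i j, cell hW N' M' i' j'⟫ = gridCov α N N' i i' * gridCov β M M' j j' := by
  rw [cell, cell, UniformSpace.Completion.inner_coe, StepSpace.inner_rectStep]
  simp only [gridCov, coe_gridPoint, hi.le, hj.le, hi'.le, hj'.le, Nat.succ_le_of_lt hi,
    Nat.succ_le_of_lt hj, Nat.succ_le_of_lt hi', Nat.succ_le_of_lt hj']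

theorem norm_cell (hα : α ≠ 0) (hβ : β ≠ 0) (hi : i < N) (hj : j < M) :
    ‖cell hW N M i j‖ = (N : ℝ) ^ (-α) * (M : ℝ) ^ (-β) := by
  have hinner := inner_cell hW hi hj hi hj
  rw [real_inner_self_eq_norm_sq, gridCov_self hα, gridCov_self hβ, ← mul_pow] at hinner
  exact (sq_eq_sq₀ (norm_nonneg _) (by positivity)).1 hinner

theorem coeFn_wiener_cell (N M i j : ℕ) : ∀ᵐ ω ∂P, wiener hW (cell hW N M i j) ω =
    W (gridPoint N (i + 1), gridPoint M (j + 1)) ω - W (gridPoint N i, gridPoint M (j + 1)) ω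
      - W (gridPoint N (i + 1), gridPoint M j) ω + W (gridPoint N i, gridPoint M j) ω := by
  set X := fun k l => (hW.memLp (gridPoint N k, gridPoint M l)).toLp
    (W (gridPoint N k, gridPoint M l))
  have hX : ∀ k l, ∀ᵐ ω ∂P, X k l ω = W (gridPoint N k, gridPoint M l) ω := fun k l =>
    (hW.memLp _).coeFn_toLp
  have hcell : wiener hW (cell hW N M i j) =
      X (i + 1) (j + 1) - X i (j + 1) - X (i + 1) j + X i j := by
    simp only [cell, wiener_coe, rectStep, map_add, map_sub, StepSpace.integral_single, X]
  rw [hcell]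
  filter_upwards [Lp.coeFn_add (X (i + 1) (j + 1) - X i (j + 1) - X (i + 1) j) (X i j),
    Lp.coeFn_sub (X (i + 1) (j + 1) - X i (j + 1)) (X (i + 1) j),
    Lp.coeFn_sub (X (i + 1) (j + 1)) (X i (j + 1)),
    hX (i + 1) (j + 1), hX i (j + 1), hX (i + 1) j, hX i j]
    with ω hadd hsub hsub' h11 h01 h10 h00
  rw [hadd, Pi.add_apply, hsub, Pi.sub_apply, hsub', Pi.sub_apply, h11, h01, h10, h00]

end Cells

/-! ### Convergence of the renormalized variations -/

section Convergence

variable {Ω : Type*} [MeasurableSpace Ω] {α β : ℝ} {W : I × I → Ω → ℝ} {P : Measure Ω}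
variable (hW : IsFractionalBrownianSheet α β W P) {q : ℕ}

theorem coeFn_multipleIntegral_symPow_cell (hq : q ≠ 0) (hα : α ≠ 0) (hβ : β ≠ 0) {N M i j : ℕ}
    (hi : i < N) (hj : j < M) :
    ∀ᵐ ω ∂P, multipleIntegral hW q (symPow q (cell hW N M i j)) ω =
      q.factorial * ((N : ℝ) ^ (-(α * q)) * (M : ℝ) ^ (-(β * q)) *
        hermitePoly q ((N : ℝ) ^ α * (M : ℝ) ^ β *
          (W (gridPoint N (i + 1), gridPoint M (j + 1)) ω
            - W (gridPoint N i, gridPoint M (j + 1)) ω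
            - W (gridPoint N (i + 1), gridPoint M j) ω + W (gridPoint N i, gridPoint M j) ω))) := by
  have hN : (0 : ℝ) < N := Nat.cast_pos.2 (by omega)
  have hM : (0 : ℝ) < M := Nat.cast_pos.2 (by omega)
  have hnorm := norm_cell hW hα hβ hi hj
  have hne : cell hW N M i j ≠ 0 := norm_ne_zero_iff.1 (hnorm ▸ by positivity)
  filter_upwards [(isMultipleIntegral_multipleIntegral hW hq).map_symPow_of_ne_zero hne,
    coeFn_wiener_cell hW N M i j] with ω hmap hcell
  rw [hmap, hcell, hnorm, mul_inv, ← Real.rpow_neg hN.le, ← Real.rpow_neg hM.le, neg_neg, neg_neg,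
    mul_pow, ← Real.rpow_mul_natCast hN.le, ← Real.rpow_mul_natCast hM.le, neg_mul, neg_mul]

theorem renormalizedVariation_eq (hq : q ≠ 0) (hα : α ≠ 0) (hβ : β ≠ 0) (N M : ℕ) :
    ∀ᵐ ω ∂P, renormalizedVariation hW q N M ω =
      normalization q α β N M * (N : ℝ) ^ (-(α * q)) * (M : ℝ) ^ (-(β * q)) *
        hermiteVariation α β W q N M ω := by
  set grid := Finset.range N ×ˢ Finset.range M
  set J := fun p : ℕ × ℕ => multipleIntegral hW q (symPow q (cell hW N M p.1 p.2))
  set c := 1 / (q.factorial : ℝ) * normalization q α β N M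
  have hJ := (Finset.eventually_all grid).2 fun p hp =>
    coeFn_multipleIntegral_symPow_cell hW hq hα hβ (Finset.mem_range.1 (Finset.mem_product.1 hp).1)
      (Finset.mem_range.1 (Finset.mem_product.1 hp).2)
  have hV : renormalizedVariation hW q N M = c • ∑ p ∈ grid, J p := by
    rw [renormalizedVariation, Finset.sum_product]
  rw [hV]
  filter_upwards [hJ, Lp.coeFn_smul c (∑ p ∈ grid, J p), Lp.coeFn_finsetSum grid J]
    with ω hcell hsmul hsum
  rw [hsmul, Pi.smul_apply, hsum, Finset.sum_apply, Finset.sum_congr rfl hcell, hermiteVariation,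
    ← Finset.sum_product', smul_eq_mul, ← Finset.mul_sum, ← Finset.mul_sum]
  simp only [grid, c]
  field_simp

theorem inner_sum_symPow_cell {N M N' M' a b a' b' : ℕ} (ha : a ≤ N) (hb : b ≤ M) (ha' : a' ≤ N')
    (hb' : b' ≤ M') :
    ⟪∑ i ∈ Finset.range a, ∑ j ∈ Finset.range b, symPow q (cell hW N M i j),
        ∑ i ∈ Finset.range a', ∑ j ∈ Finset.range b', symPow q (cell hW N' M' i j)⟫ =
      (∑ i ∈ Finset.range a, ∑ i' ∈ Finset.range a', gridCov α N N' i i' ^ q) *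
        ∑ j ∈ Finset.range b, ∑ j' ∈ Finset.range b', gridCov β M M' j j' ^ q := by
  have hcell : ∀ i ∈ Finset.range a, ∀ j ∈ Finset.range b,
      ∀ i' ∈ Finset.range a', ∀ j' ∈ Finset.range b',
      ⟪symPow q (cell hW N M i j), symPow q (cell hW N' M' i' j')⟫ =
        gridCov α N N' i i' ^ q * gridCov β M M' j j' ^ q := by
    intro i hi j hj i' hi' j' hj'
    rw [Finset.mem_range] at hi hj hi' hj'
    rw [inner_symPow, inner_cell hW (by omega) (by omega) (by omega) (by omega), mul_pow]
  rw [Finset.sum_mul_sum, sum_inner]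
  refine Finset.sum_congr rfl fun i hi => ?_
  rw [sum_inner]
  refine Finset.sum_congr rfl fun j hj => ?_
  rw [Finset.sum_mul_sum, inner_sum]
  refine Finset.sum_congr rfl fun i' hi' => ?_
  rw [inner_sum]
  exact Finset.sum_congr rfl fun j' hj' => hcell i hi j hj i' hi' j' hj'

theorem inner_kernel (t s : I) {N M N' M' : ℕ} (hN : 0 < N) (hM : 0 < M) (hN' : 0 < N')
    (hM' : 0 < M') :
    ⟪kernel hW q t s N M, kernel hW q t s N' M'⟫ =
      (1 / (q.factorial : ℝ) * √(q.factorial / (kappa q α * kappa q β))) ^ 2 *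
        (gridCovPowSum α q N N' (numCells t N) (numCells t N') *
          gridCovPowSum β q M M' (numCells s M) (numCells s M')) := by
  have hsum := inner_sum_symPow_cell hW (q := q) (numCells_le t.2.2 hN) (numCells_le s.2.2 hM)
    (numCells_le t.2.2 hN') (numCells_le s.2.2 hM')
  rw [kernel, kernel]
  refine ((real_inner_smul_left _ _ _).trans
    (congrArg _ ((real_inner_smul_right _ _ _).trans (congrArg _ hsum)))).trans ?_
  simp only [gridCovPowSum, normalization, mul_pow]
  ring

theorem cauchy_map_of_tendsto_inner {E ι : Type*} [SeminormedAddCommGroup E]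
    [InnerProductSpace ℝ E] {l : Filter ι} [l.NeBot] {f : ι → E} {L : ℝ}
    (h : Tendsto (fun z : ι × ι => ⟪f z.1, f z.2⟫) (l ×ˢ l) (𝓝 L)) : Cauchy (l.map f) := by
  rw [cauchy_map_iff, Metric.uniformity_eq_comap_nhds_zero, tendsto_comap_iff]
  refine ⟨inferInstance, ?_⟩
  have hfst : Tendsto (fun z : ι × ι => ⟪f z.1, f z.1⟫) (l ×ˢ l) (𝓝 L) :=
    h.comp (tendsto_fst.prodMk tendsto_fst)
  have hsnd : Tendsto (fun z : ι × ι => ⟪f z.2, f z.2⟫) (l ×ˢ l) (𝓝 L) :=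
    h.comp (tendsto_snd.prodMk tendsto_snd)
  have hlim := ((hfst.sub (h.const_mul 2)).add hsnd).sqrt
  rw [show L - 2 * L + L = 0 by ring, Real.sqrt_zero] at hlim
  refine hlim.congr fun z => ?_
  simp only [Function.comp_apply, real_inner_self_eq_norm_sq]
  rw [← norm_sub_sq_real, Real.sqrt_sq (norm_nonneg _), dist_eq_norm]

theorem tendsto_inner_kernel (hq : q ≠ 0) (hα1 : α ≤ 1) (hβ1 : β ≤ 1)
    (hα : -1 < (2 * α - 2) * q) (hβ : -1 < (2 * β - 2) * q) (t s : I) :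
    ∃ L, Tendsto (fun z : (ℕ × ℕ) × (ℕ × ℕ) =>
      ⟪kernel hW q t s z.1.1 z.1.2, kernel hW q t s z.2.1 z.2.2⟫) (atTop ×ˢ atTop) (𝓝 L) := by
  have hle : ∀ r : I, ∀ᶠ N : ℕ in atTop, numCells r N ≤ N := fun r =>
    (eventually_gt_atTop 0).mono fun N hN => numCells_le r.2.2 hN
  have hsumα := tendsto_gridCovPowSum hq hα1 hα (hle t) (tendsto_numCells_div t.2.1)
  have hsumβ := tendsto_gridCovPowSum hq hβ1 hβ (hle s) (tendsto_numCells_div s.2.1)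
  have hfst : Tendsto (Prod.map Prod.fst Prod.fst : (ℕ × ℕ) × (ℕ × ℕ) → ℕ × ℕ)
      (atTop ×ˢ atTop) atTop := by
    simpa only [prod_atTop_atTop_eq] using tendsto_fst_atTop.prodMap tendsto_fst_atTop
  have hsnd : Tendsto (Prod.map Prod.snd Prod.snd : (ℕ × ℕ) × (ℕ × ℕ) → ℕ × ℕ)
      (atTop ×ˢ atTop) atTop := by
    simpa only [prod_atTop_atTop_eq] using tendsto_snd_atTop.prodMap tendsto_snd_atTop
  refine ⟨_, (((hsumα.comp hfst).mul (hsumβ.comp hsnd)).const_mul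
    ((1 / (q.factorial : ℝ) * √(q.factorial / (kappa q α * kappa q β))) ^ 2)).congr' ?_⟩
  filter_upwards [eventually_pos_and_pos.prod_mk eventually_pos_and_pos] with z hz
  exact (inner_kernel hW t s hz.1.1 hz.1.2 hz.2.1 hz.2.2).symm

theorem tendsto_kernel (hq : q ≠ 0) (hα1 : α ≤ 1) (hβ1 : β ≤ 1) (hα : -1 < (2 * α - 2) * q)
    (hβ : -1 < (2 * β - 2) * q) (t s : I) :
    Tendsto (fun p : ℕ × ℕ => kernel hW q t s p.1 p.2) atTop (𝓝 (limitKernel hW q t s)) := by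
  have : CompleteSpace (symTensorPower (CanonicalSpace hW) q) :=
    (Submodule.isClosed_topologicalClosure _).completeSpace_coe
  obtain ⟨L, hL⟩ := tendsto_inner_kernel hW hq hα1 hβ1 hα hβ t s
  exact tendsto_nhds_limUnder (cauchy_map_iff_exists_tendsto.1 (cauchy_map_of_tendsto_inner hL))

theorem renormalizedVariation_eq_multipleIntegral_kernel {N M : ℕ} (hN : 0 < N) (hM : 0 < M) :
    renormalizedVariation hW q N M = multipleIntegral hW q (kernel hW q 1 1 N M) := by
  have hcells : ∀ {K : ℕ}, 0 < K → ⌊((K : ℝ) - 1) * 1⌋₊ + 1 = K := numCells_one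
  simp only [renormalizedVariation, kernel, Set.Icc.coe_one, hcells hN, hcells hM, map_smul,
    map_sum]

theorem tendsto_integral_renormalizedVariation_sub_hermiteSheet (hq : q ≠ 0) (hα1 : α ≤ 1)
    (hβ1 : β ≤ 1) (hα : -1 < (2 * α - 2) * q) (hβ : -1 < (2 * β - 2) * q) :
    Tendsto (fun p : ℕ × ℕ =>
      ∫ ω, |renormalizedVariation hW q p.1 p.2 ω - hermiteSheet hW q 1 1 ω| ^ 2 ∂P)
      atTop (𝓝 0) := by
  have hJ := ((multipleIntegral hW q).continuous.tendsto _).comp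
    (tendsto_kernel hW hq hα1 hβ1 hα hβ 1 1)
  have hnorm := (tendsto_iff_norm_sub_tendsto_zero.1 hJ).pow 2
  rw [zero_pow two_ne_zero] at hnorm
  refine hnorm.congr' ?_
  filter_upwards [eventually_pos_and_pos] with p hp
  rw [Function.comp_apply, ← renormalizedVariation_eq_multipleIntegral_kernel hW hp.1 hp.2,
    ← hermiteSheet, norm_Lp_sq_eq_integral]
  refine integral_congr_ae ?_
  filter_upwards [Lp.coeFn_sub (renormalizedVariation hW q p.1 p.2) (hermiteSheet hW q 1 1)]
    with ω hω
  rw [hω, Pi.sub_apply, sq_abs]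

end Convergence

theorem neg_one_lt_two_mul_sub_two_mul {q : ℕ} (hq : q ≠ 0) {γ : ℝ}
    (hγ : 1 - 1 / (2 * (q : ℝ)) < γ) : -1 < (2 * γ - 2) * q := by
  have hq' : (0 : ℝ) < q := Nat.cast_pos.2 (Nat.pos_of_ne_zero hq)
  rw [sub_lt_comm, lt_div_iff₀ (by positivity)] at hγ
  linarith

end HermiteVariations

open HermiteVariations in
theorem mainTheorem2 {Ω : Type*} [MeasurableSpace Ω] (P : Measure Ω) [IsProbabilityMeasure P]
    (q : ℕ) (hq : 2 ≤ q) (α β : ℝ)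
    (hα : 1 - 1 / (2 * (q : ℝ)) < α) (hα1 : α < 1) (hβ : 1 - 1 / (2 * (q : ℝ)) < β) (hβ1 : β < 1)
    (W : I × I → Ω → ℝ) (hW : IsFractionalBrownianSheet α β W P) :
    -- the multiple integral `I_q` exists and is unique
    (∃! J, IsMultipleIntegral hW q J) ∧
    -- the kernels converge in the tensor power of the canonical Hilbert space
    (∀ t s : I, Tendsto (fun p : ℕ × ℕ => kernel hW q t s p.1 p.2) atTop
      (𝓝 (limitKernel hW q t s))) ∧
    -- `Ṽ_{N,M}` is the renormalized Hermite variation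
    (∀ N M : ℕ, 0 < N → 0 < M → ∀ᵐ ω ∂P, renormalizedVariation hW q N M ω =
      normalization q α β N M * (N : ℝ) ^ (-(α * q)) * (M : ℝ) ^ (-(β * q)) *
        hermiteVariation α β W q N M ω) ∧
    -- convergence in `L²(Ω)` to the value of the Hermite sheet at `(1, 1)`
    Tendsto (fun p : ℕ × ℕ =>
      ∫ ω, |renormalizedVariation hW q p.1 p.2 ω - hermiteSheet hW q 1 1 ω| ^ 2 ∂P)
      atTop (𝓝 0) := by
  have hq0 : q ≠ 0 := by omega
  have hq1 : 1 / (2 * (q : ℝ)) < 1 := by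
    have hq2 : (2 : ℝ) ≤ q := by exact_mod_cast hq
    rw [div_lt_one] <;> linarith
  have hα0 : α ≠ 0 := ne_of_gt (by linarith)
  have hβ0 : β ≠ 0 := ne_of_gt (by linarith)
  have hαq : -1 < (2 * α - 2) * q := neg_one_lt_two_mul_sub_two_mul hq0 hα
  have hβq : -1 < (2 * β - 2) * q := neg_one_lt_two_mul_sub_two_mul hq0 hβ
  exact ⟨existsUnique_isMultipleIntegral hq0,
    tendsto_kernel hW hq0 hα1.le hβ1.le hαq hβq,
    fun N M _ _ => renormalizedVariation_eq hW hq0 hα0 hβ0 N M,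
    tendsto_integral_renormalizedVariation_sub_hermiteSheet hW hq0 hα1.le hβ1.le hαq hβq⟩
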